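/- Let $N\in\mathbb N$, $0<\lambda\le\Lambda$, and for a symmetric $N\times N$ matrix $M$ with eigenvalues $\mu_1,\dots,\mu_N$ let $\mathcal M^+(M)=\Lambda\sum_{\mu_i>0}\mu_i+\lambda\sum_{\mu_i<0}\mu_i$ (Pucci's sup-operator). Put $\tilde N_+=\frac{\lambda}{\Lambda}(N-1)+1$ and assume $\tilde N_+>2$. Put $$\tau=\frac{\tilde N_+-2}{2},\qquad \bar\lambda=\Lambda\tau^2 .$$ Let $0<\mu<\bar\lambda$ and $p>1$, and set $$\tau^\pm=\tau\pm\sqrt{\tau^2-\frac{\mu}{\Lambda}},\qquad p^\star=1+\frac{2}{\tau^+},\qquad p^{\star\star}=1+\frac{2}{\tau^-}.$$ Let $u$ be a positive radial $C^2$ solution of $$\mathcal M^+(D^2u)+\mu\,\frac{u}{|x|^2}=u^p\qquad\text{in } B_1\setminus\{0\},$$ where $B_1$ is the open unit ball of $\mathbb R^N$ centered at the origin, and write $u(x)=u(r)$, $r=|x|$. Define $$K=\Big[\Lambda\Big(\tfrac{2}{p-1}-\tau^+\Big)\Big(\tfrac{2}{p-1}-\tau^-\Big)\Big]^{\frac1{p-1}}\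 \ (\text{when } p<p^\star \text{ or } p>p^{\star\star}),\qquad \bar K=\big[\Lambda\tau^-(\tau-\tau^-)\big]^{\tau^- /2}.$$ Then: 1. if $1<p<p^\star$, then, as $r\to0$, either $r^{\frac{2}{p-1}}u(r)\to K$, or $r^{\tau^+}u(r)\to c_1$ for some constant $c_1>0$, or $r^{\tau^-}u(r)\to c_2$ for some constant $c_2>0$; 2. if $p^\star\le p<p^{\star\star}$, then $r^{\tau^-}u(r)\to c$ as $r\to0$ for some constant $c>0$; 3. if $p=p^{\star\star}$, then $r^{\tau^-}(-\log r)^{\tau^- /2}u(r)\to\bar K$ as $r\to0$; 4. if $p>p^{\star\star}$, then $r^{\frac{2}{p-1}}u(r)\to K$ as $r\to0$. -/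

import Mathlib

open Filter Topology

/-- The Pucci sup-operator `M⁺_{lam,Lam}` on symmetric matrices:
`Lam` times the sum of the positive eigenvalues plus `lam` times the sum of the negative ones.
The eigenvalues, repeated according to multiplicity, are the real roots of the characteristic
polynomial (all its roots are real when `M` is symmetric). -/
noncomputable def pucciSup {N : ℕ} (lam Lam : ℝ) (M : Matrix (Fin N) (Fin N) ℝ) : ℝ :=
  Lam * (M.charpoly.roots.filter (fun m => 0 < m)).sum +
    lam * (M.charpoly.roots.filter (fun m => m < 0)).sum

/-- The Hessian matrix `D²u(x)`, with entries the second partial derivatives of `u` at `x`. -/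
noncomputable def hessianMatrix {N : ℕ} (u : EuclideanSpace ℝ (Fin N) → ℝ)
    (x : EuclideanSpace ℝ (Fin N)) : Matrix (Fin N) (Fin N) ℝ :=
  Matrix.of fun i j =>
    fderiv ℝ (fderiv ℝ u) x (EuclideanSpace.single i 1) (EuclideanSpace.single j 1)

/-- The punctured open unit ball `B₁ \ {0}` of `ℝ^N`. -/
def puncturedBall (N : ℕ) : Set (EuclideanSpace ℝ (Fin N)) :=
  Metric.ball 0 1 \ {0}

/-- `u` is a positive, radial, classical (`C²`) solution of
`M⁺(D²u) + μ u / |x|² = u^p` in the punctured unit ball. Only the values of `u` on the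
punctured ball matter. -/
structure IsPosRadialSolution {N : ℕ} (lam Lam μ p : ℝ)
    (u : EuclideanSpace ℝ (Fin N) → ℝ) : Prop where
  contDiffOn : ContDiffOn ℝ 2 u (puncturedBall N)
  radial : ∀ x ∈ puncturedBall N, ∀ y ∈ puncturedBall N, ‖x‖ = ‖y‖ → u x = u y
  pos : ∀ x ∈ puncturedBall N, 0 < u x
  equation : ∀ x ∈ puncturedBall N,
    pucciSup lam Lam (hessianMatrix u x) + μ * (u x / ‖x‖ ^ 2) = u x ^ p

/-- The dimension-like parameter `Ñ₊ = (lam / Lam) (N - 1) + 1`. -/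
noncomputable def dimPlus (N : ℕ) (lam Lam : ℝ) : ℝ := lam / Lam * ((N : ℝ) - 1) + 1

/-- `τ = (Ñ₊ - 2) / 2`. -/
noncomputable def tauMid (N : ℕ) (lam Lam : ℝ) : ℝ := (dimPlus N lam Lam - 2) / 2

/-- The principal eigenvalue `lambda-bar = Lam τ²`. -/
noncomputable def lamBar (N : ℕ) (lam Lam : ℝ) : ℝ := Lam * tauMid N lam Lam ^ 2

/-- `τ⁺ = τ + √(τ² - μ / Lam)`. -/
noncomputable def tauPlus (N : ℕ) (lam Lam μ : ℝ) : ℝ :=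
  tauMid N lam Lam + √(tauMid N lam Lam ^ 2 - μ / Lam)

/-- `τ⁻ = τ - √(τ² - μ / Lam)`. -/
noncomputable def tauMinus (N : ℕ) (lam Lam μ : ℝ) : ℝ :=
  tauMid N lam Lam - √(tauMid N lam Lam ^ 2 - μ / Lam)

/-- The critical exponent `p* = 1 + 2 / τ⁺`. -/
noncomputable def pStar (N : ℕ) (lam Lam μ : ℝ) : ℝ := 1 + 2 / tauPlus N lam Lam μ

/-- The critical exponent `p** = 1 + 2 / τ⁻`. -/
noncomputable def pStarStar (N : ℕ) (lam Lam μ : ℝ) : ℝ := 1 + 2 / tauMinus N lam Lam μ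

/-- The constant `K = [Lam (2/(p-1) - τ⁺) (2/(p-1) - τ⁻)]^{1/(p-1)}`. -/
noncomputable def constK (N : ℕ) (lam Lam μ p : ℝ) : ℝ :=
  (Lam * (2 / (p - 1) - tauPlus N lam Lam μ) * (2 / (p - 1) - tauMinus N lam Lam μ)) ^
    (1 / (p - 1))

/-- The constant `K-bar = [Lam τ⁻ (τ - τ⁻)]^{τ⁻/2}`. -/
noncomputable def constKBar (N : ℕ) (lam Lam μ : ℝ) : ℝ :=
  (Lam * tauMinus N lam Lam μ * (tauMid N lam Lam - tauMinus N lam Lam μ)) ^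
    (tauMinus N lam Lam μ / 2)

/-- `|x|^γ u(x) → c` as `x → 0`. -/
def BehavesLikePower {N : ℕ} (u : EuclideanSpace ℝ (Fin N) → ℝ) (γ c : ℝ) : Prop :=
  Tendsto (fun x => ‖x‖ ^ γ * u x) (𝓝[≠] 0) (𝓝 c)

/-! In the variable t = -log r put X = -r u'/u and W = r² u^(p-1). The equation becomes an
autonomous planar system X' = F(X, W), W' = (p-1)(X - β)W with β = 2/(p-1), where F is strictly
increasing in W. Near the relevant equilibria F(x, w) = w/Λ - (x - τ⁺)(x - τ⁻). The equilibria with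
W = 0 are X = τ⁺ and X = τ⁻; the only possible one with W > 0 is (β, w₀), w₀ = Λ(β - τ⁺)(β - τ⁻).

Monotonicity of F in W replaces phase-plane theory. If X meets β while W > w₀, then X increases
there; afterwards W grows and X can never come back. The case W < w₀ is symmetric. Hence W is
eventually monotone or equal to w₀ (`IsOrbit.trichotomy`). A Keller–Osserman estimate prevents
blow-up of W, and monotonicity of W forces X to converge too. So either W → w₀ > 0, which is the
behaviour with constant K, or W → 0 and X tends to a root τ± ≤ β (`IsOrbit.alternative`).

The position of β relative to τ⁻ < τ⁺ selects the surviving cases. When X tends to a root γ < β, W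
is integrable and log u - γt converges. The two resonances need first integrals: for β = τ⁺ the
limit τ⁺ is impossible, and for β = τ⁻ one gets the decay tW → Λ(τ⁺ - τ⁻)/(p-1), whence the
logarithm. -/

/-! ### Scalar differential inequalities and limits at infinity. -/

theorem tendsto_atTop_of_le_deriv {f f' : ℝ → ℝ} {c : ℝ} (hc : 0 < c)
    (h : ∀ᶠ t in atTop, HasDerivAt f (f' t) t ∧ c ≤ f' t) : Tendsto f atTop atTop := by
  obtain ⟨T, hT⟩ := eventually_atTop.1 h
  have key : ∀ t ≥ T, c * (t - T) + f T ≤ f t := by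
    intro t ht
    have := (convex_Ici T).mul_sub_le_image_sub_of_le_deriv (f := f) (C := c)
      (fun s hs => (hT s hs).1.continuousAt.continuousWithinAt)
      (fun s hs => by
        rw [interior_Ici] at hs
        exact (hT s hs.le).1.differentiableAt.differentiableWithinAt)
      (fun s hs => by
        rw [interior_Ici] at hs
        rw [(hT s hs.le).1.deriv]; exact (hT s hs.le).2) T (Set.mem_Ici.2 le_rfl) t ht ht
    linarith
  refine tendsto_atTop_mono' atTop (eventually_atTop.2 ⟨T, key⟩) ?_
  refine tendsto_atTop_add_const_right _ _ (Tendsto.const_mul_atTop hc ?_)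
  exact tendsto_atTop_add_const_right _ _ tendsto_id

theorem tendsto_atBot_of_deriv_le {f f' : ℝ → ℝ} {c : ℝ} (hc : c < 0)
    (h : ∀ᶠ t in atTop, HasDerivAt f (f' t) t ∧ f' t ≤ c) : Tendsto f atTop atBot := by
  have := tendsto_atTop_of_le_deriv (f := fun t => - f t) (f' := fun t => - f' t) (c := -c)
    (by linarith) (h.mono fun t ht => ⟨ht.1.neg, by linarith [ht.2]⟩)
  simpa [Function.comp_def] using tendsto_neg_atTop_atBot.comp this

theorem deriv_limit_eq_zero {f f' : ℝ → ℝ} {a d : ℝ}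
    (h : ∀ᶠ t in atTop, HasDerivAt f (f' t) t) (hf : Tendsto f atTop (𝓝 a))
    (hf' : Tendsto f' atTop (𝓝 d)) : d = 0 := by
  rcases lt_trichotomy d 0 with hd | hd | hd
  · have := tendsto_atBot_of_deriv_le (f := f) (f' := f') (c := d / 2) (by linarith)
      (h.and ((hf'.eventually_lt_const (show d < d / 2 by linarith)).mono fun t ht => ht.le))
    exact absurd hf (not_tendsto_nhds_of_tendsto_atBot this _)
  · exact hd
  · have := tendsto_atTop_of_le_deriv (f := f) (f' := f') (c := d / 2) (by linarith)
      (h.and ((hf'.eventually_const_lt (show d / 2 < d by linarith)).mono fun t ht => ht.le))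
    exact absurd hf (not_tendsto_nhds_of_tendsto_atTop this _)

theorem HasDerivAt.eventually_pos_right {f : ℝ → ℝ} {d t : ℝ} (h : HasDerivAt f d t)
    (h0 : f t = 0) (hd : 0 < d) : ∀ᶠ s in 𝓝[>] t, 0 < f s := by
  have := (hasDerivAt_iff_tendsto_slope.1 h).eventually_const_lt hd
  have h2 : ∀ᶠ s in 𝓝[>] t, 0 < slope f t s :=
    this.filter_mono (nhdsWithin_mono _ fun s hs => ne_of_gt hs)
  filter_upwards [h2, self_mem_nhdsWithin] with s hs hts
  rw [slope_def_field, h0, sub_zero] at hs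
  exact (div_pos_iff_of_pos_right (sub_pos.2 hts)).1 hs

theorem HasDerivAt.eventually_neg_left {f : ℝ → ℝ} {d t : ℝ} (h : HasDerivAt f d t)
    (h0 : f t = 0) (hd : 0 < d) : ∀ᶠ s in 𝓝[<] t, f s < 0 := by
  have := (hasDerivAt_iff_tendsto_slope.1 h).eventually_const_lt hd
  have h2 : ∀ᶠ s in 𝓝[<] t, 0 < slope f t s :=
    this.filter_mono (nhdsWithin_mono _ fun s hs => ne_of_lt hs)
  filter_upwards [h2, self_mem_nhdsWithin] with s hs hts
  rw [slope_def_field, h0, sub_zero] at hs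
  by_contra hcon
  have : f s / (s - t) ≤ 0 := div_nonpos_of_nonneg_of_nonpos (not_lt.1 hcon) (sub_neg.2 hts).le
  linarith

/-- A function whose derivative is positive at each zero reached without having been negative
before stays nonnegative. -/
theorem nonneg_of_pos_deriv_at_zeros {f f' : ℝ → ℝ} {a : ℝ} (ha : 0 ≤ f a)
    (hf : ∀ t ≥ a, HasDerivAt f (f' t) t)
    (H : ∀ t ≥ a, (∀ s ∈ Set.Icc a t, 0 ≤ f s) → f t = 0 → 0 < f' t) :
    ∀ t ≥ a, 0 ≤ f t := by
  intro t1 ht1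
  by_contra hneg
  push Not at hneg
  set S : Set ℝ := {t | a ≤ t ∧ f t < 0} with hS
  have hSne : S.Nonempty := ⟨t1, ht1, hneg⟩
  have hSb : BddBelow S := ⟨a, fun t ht => ht.1⟩
  set m := sInf S
  have ham : a ≤ m := le_csInf hSne fun t ht => ht.1
  have hlt : ∀ s, a ≤ s → s < m → 0 ≤ f s := by
    intro s has hs
    by_contra hc
    exact absurd (csInf_le hSb (show s ∈ S from ⟨has, not_le.1 hc⟩)) (not_le.2 hs)
  have hcont := (hf m ham).continuousAt
  have hm0 : 0 ≤ f m := by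
    rcases ham.eq_or_lt with h | h
    · rw [← h]; exact ha
    · have : ∀ᶠ s in 𝓝[<] m, 0 ≤ f s := by
        filter_upwards [Ioo_mem_nhdsLT h] with s hs using hlt s hs.1.le hs.2
      exact ge_of_tendsto (hcont.tendsto.mono_left nhdsWithin_le_nhds) this
  have hpos : ∀ᶠ s in 𝓝[>] m, 0 ≤ f s := by
    rcases hm0.eq_or_lt with h | h
    · refine ((hf m ham).eventually_pos_right h.symm (H m ham ?_ h.symm)).mono fun s hs => hs.le
      intro s hs
      rcases hs.2.eq_or_lt with h' | h'
      · rw [h']; exact hm0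
      · exact hlt s hs.1 h'
    · exact ((hcont.eventually (lt_mem_nhds h)).filter_mono nhdsWithin_le_nhds).mono
        fun s hs => hs.le
  obtain ⟨b, hmb, hb⟩ := mem_nhdsGT_iff_exists_Ioo_subset.1 hpos
  obtain ⟨s, hsS, hsb⟩ := exists_lt_of_csInf_lt hSne (show sInf S < b from hmb)
  have hms : m ≤ s := csInf_le hSb hsS
  rcases hms.eq_or_lt with h | h
  · rw [← h] at hsS; exact absurd hsS.2 (not_lt.2 hm0)
  · exact absurd hsS.2 (not_lt.2 (hb ⟨h, hsb⟩))

theorem pos_of_pos_deriv_at_zeros {f f' : ℝ → ℝ} {a : ℝ} (ha : 0 ≤ f a)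
    (hf : ∀ t ≥ a, HasDerivAt f (f' t) t)
    (H : ∀ t ≥ a, (∀ s ∈ Set.Icc a t, 0 ≤ f s) → f t = 0 → 0 < f' t) :
    ∀ t > a, 0 < f t := by
  intro t ht
  have hnn := nonneg_of_pos_deriv_at_zeros ha hf H
  refine (hnn t ht.le).lt_of_ne' fun h0 => ?_
  have h1 := (hf t ht.le).eventually_neg_left h0 (H t ht.le (fun s hs => hnn s hs.1) h0)
  obtain ⟨s, hs, hs'⟩ := (h1.and (Ioo_mem_nhdsLT ht)).exists
  exact absurd (hnn s hs'.1.le) (not_le.2 hs)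

/-- A level that can only be crossed downwards is crossed at most once. -/
theorem eventually_lt_or_gt_of_neg_deriv_on_level {f f' : ℝ → ℝ} {c : ℝ}
    (h : ∀ᶠ t in atTop, HasDerivAt f (f' t) t ∧ (f t = c → f' t < 0)) :
    (∀ᶠ t in atTop, f t < c) ∨ ∀ᶠ t in atTop, c < f t := by
  obtain ⟨T, hT⟩ := eventually_atTop.1 h
  by_cases hex : ∃ t ≥ T, f t ≤ c
  · obtain ⟨a, haT, ha⟩ := hex
    left
    have := pos_of_pos_deriv_at_zeros (f := fun t => c - f t) (f' := fun t => - f' t) (a := a)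
      (by linarith) (fun t ht => by simpa using (hT t (haT.trans ht)).1.const_sub c)
      (fun t ht _ h0 => by
        have := (hT t (haT.trans ht)).2 (by linarith); linarith)
    filter_upwards [eventually_gt_atTop a] with t ht
    linarith [this t ht]
  · push Not at hex
    exact Or.inr (eventually_atTop.2 ⟨T, hex⟩)

theorem eventually_lt_or_gt_of_pos_deriv_on_level {f f' : ℝ → ℝ} {c : ℝ}
    (h : ∀ᶠ t in atTop, HasDerivAt f (f' t) t ∧ (f t = c → 0 < f' t)) :
    (∀ᶠ t in atTop, f t < c) ∨ ∀ᶠ t in atTop, c < f t := by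
  have := eventually_lt_or_gt_of_neg_deriv_on_level (f := fun t => - f t) (f' := fun t => - f' t)
    (c := -c) (h.mono fun t ht => ⟨ht.1.neg, fun h0 => by have := ht.2 (by linarith); linarith⟩)
  simpa [or_comm] using this

theorem exists_tendsto_of_eventually_lt_or_gt {f : ℝ → ℝ} {a b : ℝ}
    (ha : ∀ᶠ t in atTop, a ≤ f t) (hb : ∀ᶠ t in atTop, f t ≤ b)
    (h : ∀ c, (∀ᶠ t in atTop, f t < c) ∨ ∀ᶠ t in atTop, c < f t) :
    ∃ x, Tendsto f atTop (𝓝 x) := by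
  refine tendsto_of_no_upcrossings dense_univ ?_ ⟨b, hb⟩ ⟨a, ha⟩
  rintro x - y - hxy ⟨h1, h2⟩
  rcases h x with h | h
  · obtain ⟨t, ht1, ht2⟩ := (h2.and_eventually h).exists
    linarith
  · obtain ⟨t, ht1, ht2⟩ := (h1.and_eventually h).exists
    linarith

theorem tendsto_nhds_or_atTop_of_monotoneOn {f : ℝ → ℝ} {T : ℝ} (h : MonotoneOn f (Set.Ici T)) :
    Tendsto f atTop atTop ∨ ∃ x, Tendsto f atTop (𝓝 x) ∧ ∀ t ≥ T, f t ≤ x := by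
  have hmono : Monotone fun t => f (max t T) := fun s t hst =>
    h (Set.mem_Ici.2 (le_max_right _ _)) (Set.mem_Ici.2 (le_max_right _ _)) (max_le_max_right _ hst)
  have heq : (fun t => f (max t T)) =ᶠ[atTop] f := by
    filter_upwards [eventually_ge_atTop T] with t ht
    rw [max_eq_left ht]
  rcases tendsto_atTop_of_monotone hmono with h1 | ⟨x, hx⟩
  · exact Or.inl (h1.congr' heq)
  · refine Or.inr ⟨x, hx.congr' heq, fun t ht => ?_⟩
    have := hmono.ge_of_tendsto hx t
    simpa [max_eq_left ht] using this

theorem tendsto_nhds_of_antitoneOn_of_le {f : ℝ → ℝ} {T b : ℝ} (h : AntitoneOn f (Set.Ici T))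
    (hb : ∀ t ≥ T, b ≤ f t) : ∃ x, Tendsto f atTop (𝓝 x) ∧ b ≤ x := by
  rcases tendsto_nhds_or_atTop_of_monotoneOn (f := fun t => - f t) h.neg with h1 | ⟨x, hx, -⟩
  · obtain ⟨t, ht, ht'⟩ := ((h1.eventually_gt_atTop (-b)).and (eventually_ge_atTop T)).exists
    linarith [hb t ht']
  · refine ⟨-x, by simpa using hx.neg, ?_⟩
    exact ge_of_tendsto (by simpa using hx.neg) (eventually_atTop.2 ⟨T, hb⟩)

theorem le_of_hasDerivAt_nonneg {f f' : ℝ → ℝ} {a b : ℝ} (hab : a ≤ b)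
    (h : ∀ t ∈ Set.Icc a b, HasDerivAt f (f' t) t ∧ 0 ≤ f' t) : f a ≤ f b := by
  refine monotoneOn_of_deriv_nonneg (convex_Icc a b)
    (fun s hs => (h s hs).1.continuousAt.continuousWithinAt)
    (fun s hs => (h s (interior_subset hs)).1.differentiableAt.differentiableWithinAt)
    (fun s hs => ?_) (Set.left_mem_Icc.2 hab) (Set.right_mem_Icc.2 hab) hab
  rw [(h s (interior_subset hs)).1.deriv]
  exact (h s (interior_subset hs)).2

theorem lt_of_hasDerivAt_pos {f f' : ℝ → ℝ} {a b : ℝ} (hab : a < b)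
    (h : ∀ t ∈ Set.Icc a b, HasDerivAt f (f' t) t ∧ 0 < f' t) : f a < f b := by
  refine strictMonoOn_of_deriv_pos (convex_Icc a b)
    (fun s hs => (h s hs).1.continuousAt.continuousWithinAt)
    (fun s hs => ?_) (Set.left_mem_Icc.2 hab.le) (Set.right_mem_Icc.2 hab.le) hab
  rw [(h s (interior_subset hs)).1.deriv]
  exact (h s (interior_subset hs)).2

/-! ### Global behaviour of the planar system. -/

/-- Orbits on `(0, ∞)` of the planar system `X' = F(X, W)`, `W' = k (X - β) W` with `W > 0`. -/
structure IsOrbit (F : ℝ → ℝ → ℝ) (k β : ℝ) (X W : ℝ → ℝ) : Prop where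
  pos : ∀ t > 0, 0 < W t
  derivX : ∀ t > 0, HasDerivAt X (F (X t) (W t)) t
  derivW : ∀ t > 0, HasDerivAt W (k * (X t - β) * W t) t

namespace IsOrbit

variable {F : ℝ → ℝ → ℝ} {k β w₀ : ℝ} {X W : ℝ → ℝ}

/-- As long as X ≥ β, W does not decrease and so remains above w₀; hence X' > 0 at any contact with
β. -/
theorem gt_of_crossing (h : IsOrbit F k β X W) (hk : 0 < k) (hF : ∀ x, StrictMono (F x))
    (h0 : F β w₀ = 0) {a : ℝ} (ha : 0 < a) (hX : X a = β) (hW : w₀ < W a) :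
    ∀ t > a, β < X t := by
  intro t ht
  have := pos_of_pos_deriv_at_zeros (f := fun t => X t - β) (f' := fun t => F (X t) (W t)) (a := a)
    (by linarith) (fun t ht => (h.derivX t (ha.trans_le ht)).sub_const β) (fun t ht hs hz => ?_) t ht
  · linarith
  · have hWt : W a ≤ W t := le_of_hasDerivAt_nonneg ht fun s hs' =>
      ⟨h.derivW s (ha.trans_le hs'.1),
        mul_nonneg (mul_nonneg hk.le (hs s hs')) (h.pos s (ha.trans_le hs'.1)).le⟩
    have hXt : X t = β := by linarith
    rw [hXt, ← h0]
    exact hF β (hW.trans_le hWt)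

theorem lt_of_crossing (h : IsOrbit F k β X W) (hk : 0 < k) (hF : ∀ x, StrictMono (F x))
    (h0 : F β w₀ = 0) {a : ℝ} (ha : 0 < a) (hX : X a = β) (hW : W a < w₀) :
    ∀ t > a, X t < β := by
  intro t ht
  have := pos_of_pos_deriv_at_zeros (f := fun t => β - X t) (f' := fun t => - F (X t) (W t))
    (a := a) (by linarith) (fun t ht => (h.derivX t (ha.trans_le ht)).const_sub β)
    (fun t ht hs hz => ?_) t ht
  · linarith
  · have hWt : - W a ≤ - W t := le_of_hasDerivAt_nonneg (f := fun t => - W t) ht fun s hs' =>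
      ⟨(h.derivW s (ha.trans_le hs'.1)).neg, by
        have := mul_nonneg (mul_nonneg hk.le (hs s hs')) (h.pos s (ha.trans_le hs'.1)).le
        linarith⟩
    have hXt : X t = β := by linarith
    have := hF β (show W t < w₀ by linarith)
    rw [h0] at this
    rw [hXt]; linarith

theorem trichotomy (h : IsOrbit F k β X W) (hk : 0 < k) (hF : ∀ x, StrictMono (F x))
    (h0 : F β w₀ = 0) :
    (∀ᶠ t in atTop, β < X t) ∨ (∀ᶠ t in atTop, X t < β) ∨ ∀ᶠ t in atTop, W t = w₀ := by
  by_cases h1 : ∃ a > 0, X a = β ∧ w₀ < W a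
  · obtain ⟨a, ha, hX, hW⟩ := h1
    exact Or.inl ((eventually_gt_atTop a).mono (h.gt_of_crossing hk hF h0 ha hX hW))
  by_cases h2 : ∃ a > 0, X a = β ∧ W a < w₀
  · obtain ⟨a, ha, hX, hW⟩ := h2
    exact Or.inr (Or.inl ((eventually_gt_atTop a).mono (h.lt_of_crossing hk hF h0 ha hX hW)))
  push Not at h1 h2
  have hcrit : ∀ t > 0, X t = β → W t = w₀ := fun t ht hX => le_antisymm (h1 t ht hX) (h2 t ht hX)
  by_cases h3 : ∃ᶠ t in atTop, X t = β
  · right; right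
    obtain ⟨a, ha, haX⟩ := frequently_atTop.1 h3 1
    refine eventually_atTop.2 ⟨a, fun t ht => ?_⟩
    obtain ⟨b, hb, hbX⟩ := frequently_atTop.1 h3 t
    have ha0 : (0 : ℝ) < a := by linarith
    have hcont : ContinuousOn W (Set.Icc a b) := fun s hs =>
      (h.derivW s (ha0.trans_le hs.1)).continuousAt.continuousWithinAt
    have hne : (Set.Icc a b).Nonempty := ⟨t, ht, hb⟩
    -- Every extremum of W between two contact times is itself a contact time: an endpoint, or an
    -- interior zero of W', where X = β. So the maximum and the minimum of W are both w₀.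
    have key : ∀ m ∈ Set.Icc a b, IsExtrOn W (Set.Icc a b) m → W m = w₀ := by
      intro m hm hext
      rcases hm.1.eq_or_lt with e | hlt
      · rw [← e]; exact hcrit a ha0 haX
      rcases hm.2.eq_or_lt with e | hlt'
      · rw [e]; exact hcrit b (by linarith) hbX
      have hm0 : 0 < m := by linarith
      have := (hext.isLocalExtr (Icc_mem_nhds hlt hlt')).hasDerivAt_eq_zero (h.derivW m hm0)
      refine hcrit m hm0 ?_
      have hp := h.pos m hm0
      rcases mul_eq_zero.1 this with e | e
      · rcases mul_eq_zero.1 e with e | e <;> linarith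
      · linarith
    obtain ⟨M, hM, hMmax⟩ := isCompact_Icc.exists_isMaxOn hne hcont
    obtain ⟨m, hm, hmin⟩ := isCompact_Icc.exists_isMinOn hne hcont
    have e1 := key M hM hMmax.isExtr
    have e2 := key m hm hmin.isExtr
    have l1 : W t ≤ W M := hMmax ⟨ht, hb⟩
    have l2 : W m ≤ W t := hmin ⟨ht, hb⟩
    linarith
  · rw [not_frequently] at h3
    obtain ⟨T, hT⟩ := eventually_atTop.1 (h3.and (eventually_gt_atTop 0))
    have hconn : IsPreconnected (X '' Set.Ici T) := isPreconnected_Ici.image X fun s hs =>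
      (h.derivX s (hT s hs).2).continuousAt.continuousWithinAt
    have hT' := (hT T le_rfl).1
    rcases lt_or_gt_of_ne hT' with hl | hg
    · right; left
      refine eventually_atTop.2 ⟨T, fun t ht => lt_of_not_ge fun hc => ?_⟩
      obtain ⟨s, hs, hsX⟩ := hconn.Icc_subset ⟨T, Set.self_mem_Ici, rfl⟩ ⟨t, ht, rfl⟩ ⟨hl.le, hc⟩
      exact (hT s hs).1 hsX
    · left
      refine eventually_atTop.2 ⟨T, fun t ht => lt_of_not_ge fun hc => ?_⟩
      obtain ⟨s, hs, hsX⟩ := hconn.Icc_subset ⟨t, ht, rfl⟩ ⟨T, Set.self_mem_Ici, rfl⟩ ⟨hc, hg.le⟩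
      exact (hT s hs).1 hsX

theorem strictMono_of_gt (h : IsOrbit F k β X W) (hk : 0 < k) {T : ℝ} (hT : 0 < T)
    (hX : ∀ t ≥ T, β < X t) : StrictMonoOn W (Set.Ici T) := by
  intro s hs t _ hst
  exact lt_of_hasDerivAt_pos hst fun r hr => by
    have hr0 : T ≤ r := le_trans hs hr.1
    exact ⟨h.derivW r (hT.trans_le hr0), mul_pos (mul_pos hk (sub_pos.2 (hX r hr0)))
      (h.pos r (hT.trans_le hr0))⟩

theorem strictAnti_of_lt (h : IsOrbit F k β X W) (hk : 0 < k) {T : ℝ} (hT : 0 < T)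
    (hX : ∀ t ≥ T, X t < β) : StrictAntiOn W (Set.Ici T) := by
  intro s hs t _ hst
  have := lt_of_hasDerivAt_pos (f := fun t => - W t) hst fun r hr => by
    have hr0 : T ≤ r := le_trans hs hr.1
    have := mul_pos (mul_pos hk (sub_pos.2 (hX r hr0))) (h.pos r (hT.trans_le hr0))
    exact ⟨(h.derivW r (hT.trans_le hr0)).neg, by linarith⟩
  simpa using this

/-- If `F c (W t)` has eventually a constant sign for every `c`, a bounded `X` converges. -/
theorem exists_tendsto_X (h : IsOrbit F k β X W) {a b : ℝ}
    (ha : ∀ᶠ t in atTop, a ≤ X t) (hb : ∀ᶠ t in atTop, X t ≤ b)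
    (hs : ∀ c, (∀ᶠ t in atTop, F c (W t) < 0) ∨ ∀ᶠ t in atTop, 0 < F c (W t)) :
    ∃ x, Tendsto X atTop (𝓝 x) := by
  refine exists_tendsto_of_eventually_lt_or_gt ha hb fun c => ?_
  rcases hs c with hc | hc
  · refine eventually_lt_or_gt_of_neg_deriv_on_level (f' := fun t => F (X t) (W t)) ?_
    filter_upwards [hc, eventually_gt_atTop 0] with t ht ht0
    exact ⟨h.derivX t ht0, fun e => by rw [e]; exact ht⟩
  · refine eventually_lt_or_gt_of_pos_deriv_on_level (f' := fun t => F (X t) (W t)) ?_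
    filter_upwards [hc, eventually_gt_atTop 0] with t ht ht0
    exact ⟨h.derivX t ht0, fun e => by rw [e]; exact ht⟩

theorem field_limit_eq_zero (h : IsOrbit F k β X W) (hFc : Continuous (Function.uncurry F))
    {x w : ℝ} (hX : Tendsto X atTop (𝓝 x)) (hW : Tendsto W atTop (𝓝 w)) : F x w = 0 := by
  refine deriv_limit_eq_zero (f' := fun t => F (X t) (W t))
    ((eventually_gt_atTop 0).mono fun t ht => h.derivX t ht) hX ?_
  exact (hFc.tendsto (x, w)).comp (hX.prodMk_nhds hW)

theorem eq_of_limits (h : IsOrbit F k β X W) (hk : 0 < k) (hF : ∀ x, StrictMono (F x))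
    (hFc : Continuous (Function.uncurry F)) (h0 : F β w₀ = 0) {x w : ℝ}
    (hX : Tendsto X atTop (𝓝 x)) (hW : Tendsto W atTop (𝓝 w)) (hw : 0 < w) : w = w₀ := by
  have h1 := h.field_limit_eq_zero hFc hX hW
  have h2 : k * (x - β) * w = 0 := deriv_limit_eq_zero (f' := fun t => k * (X t - β) * W t)
    ((eventually_gt_atTop 0).mono fun t ht => h.derivW t ht) hW
    (((hX.sub_const β).const_mul k).mul hW)
  have hx : x = β := by
    rcases mul_eq_zero.1 h2 with e | e
    · rcases mul_eq_zero.1 e with e | e <;> linarith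
    · linarith
  rw [hx] at h1
  exact (hF β).injective (h1.trans h0.symm)

/-- A Keller–Osserman type bound: `W` cannot blow up along a global orbit staying in `X > β`. -/
theorem not_tendsto_atTop (h : IsOrbit F k β X W) (hk : 0 < k) (hβ : 0 < β) {c w₁ : ℝ} (hc : 0 < c)
    (hlow : ∀ x ≥ 0, ∀ w ≥ w₁, c * w - x ^ 2 ≤ F x w) (hX : ∀ᶠ t in atTop, β < X t) :
    ¬ Tendsto W atTop atTop := by
  intro hW
  -- Let G = X²/W. This δ makes G' ≥ cX ≥ cβ whenever G ≤ δ, so eventually G > δ. Then X ≥ √(δW), W'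
  -- is at least of order W^(3/2), and W^(-1/2) would become negative in finite time.
  set δ := c / (2 * (1 + k / 2)) with hδ
  have hδ0 : 0 < δ := by positivity
  have hδ1 : (1 + k / 2) * δ = c / 2 := by rw [hδ]; field_simp
  set G' : ℝ → ℝ := fun t =>
    ((2 * X t ^ 1 * F (X t) (W t)) * W t - X t ^ 2 * (k * (X t - β) * W t)) / W t ^ 2 with hG'
  have hder : ∀ t > 0, HasDerivAt (fun t => X t ^ 2 / W t) (G' t) t := fun t ht => by
    have : HasDerivAt (fun t => X t ^ 2 / W t) _ t :=
      ((h.derivX t ht).pow 2).div (h.derivW t ht) (h.pos t ht).ne'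
    convert this using 1
    simp [hG']
  have hest : ∀ᶠ t in atTop, X t ^ 2 / W t ≤ δ → c * β ≤ G' t := by
    filter_upwards [hX, hW.eventually_ge_atTop w₁, eventually_gt_atTop 0] with t ht1 ht2 ht0 hle
    have hx : 0 < X t := hβ.trans ht1
    have hw := h.pos t ht0
    have hF := hlow (X t) hx.le (W t) ht2
    have hG : X t ^ 2 ≤ δ * W t := (div_le_iff₀ hw).1 hle
    rw [hG', le_div_iff₀ (by positivity)]
    have e1 : c / 2 * W t ≤ F (X t) (W t) - k / 2 * X t ^ 2 := by
      nlinarith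
    have e2 : 2 * X t * W t * (c / 2 * W t) ≤
        2 * X t * W t * (F (X t) (W t) - k / 2 * X t ^ 2) :=
      mul_le_mul_of_nonneg_left e1 (by positivity)
    have e3 : c * β * W t ^ 2 ≤ c * X t * W t ^ 2 := by gcongr
    have e4 : 0 ≤ X t ^ 2 * k * β * W t := by positivity
    nlinarith
  have hbig : ∀ᶠ t in atTop, δ < X t ^ 2 / W t := by
    rcases eventually_lt_or_gt_of_pos_deriv_on_level (f := fun t => X t ^ 2 / W t) (f' := G')
      (c := δ) (by
        filter_upwards [hest, eventually_gt_atTop 0] with t ht ht0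
        exact ⟨hder t ht0, fun e => (by positivity : 0 < c * β).trans_le (ht e.le)⟩) with hl | hg
    · exfalso
      have := tendsto_atTop_of_le_deriv (f := fun t => X t ^ 2 / W t) (f' := G') (c := c * β)
        (by positivity) (by
          filter_upwards [hest, eventually_gt_atTop 0, hl] with t ht ht0 htl
          exact ⟨hder t ht0, ht htl.le⟩)
      obtain ⟨t, ht1, ht2⟩ := ((this.eventually_gt_atTop δ).and hl).exists
      linarith
    · exact hg
  have hder2 : ∀ t > 0, HasDerivAt (fun t => (√(W t))⁻¹)
      (-(k * (X t - β) * W t / (2 * √(W t))) / √(W t) ^ 2) t := fun t ht =>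
    ((h.derivW t ht).sqrt (h.pos t ht).ne').inv (Real.sqrt_pos.2 (h.pos t ht)).ne'
  have := tendsto_atBot_of_deriv_le (f := fun t => (√(W t))⁻¹) (c := -(k * √δ / 4))
    (f' := fun t => -(k * (X t - β) * W t / (2 * √(W t))) / √(W t) ^ 2)
    (by have := Real.sqrt_pos.2 hδ0; have : 0 < k * √δ / 4 := by positivity
        linarith) (by
      filter_upwards [hbig, eventually_gt_atTop 0, hX, hW.eventually_ge_atTop ((2 * β) ^ 2 / δ)]
        with t ht ht0 htX htW
      refine ⟨hder2 t ht0, ?_⟩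
      have hw := h.pos t ht0
      have hs := Real.sqrt_pos.2 hw
      have hx : 0 < X t := hβ.trans htX
      have hG : δ * W t ≤ X t ^ 2 := ((lt_div_iff₀ hw).1 ht).le
      have h2 : (2 * β) ^ 2 ≤ X t ^ 2 := by
        rw [div_le_iff₀ hδ0] at htW; nlinarith
      have h2' : 2 * β ≤ X t := le_of_sq_le_sq h2 hx.le
      have h3 : √δ * √(W t) ≤ X t := by
        rw [← Real.sqrt_mul hδ0.le]; exact Real.sqrt_le_iff.2 ⟨hx.le, hG⟩
      have hsq : √(W t) ^ 2 = W t := Real.sq_sqrt hw.le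
      rw [hsq, div_le_iff₀ hw, neg_mul, neg_le_neg_iff, le_div_iff₀ (by positivity)]
      have h4 : √δ * √(W t) * (k * W t) ≤ 2 * (X t - β) * (k * W t) :=
        mul_le_mul_of_nonneg_right (by linarith) (by positivity)
      nlinarith)
  obtain ⟨t, ht, ht0⟩ := ((this.eventually_lt_atBot 0).and (eventually_gt_atTop 0)).exists
  exact absurd ht (not_lt.2 (by positivity))

/-- Below -M, (1/X)' ≥ 1/2: the negative quantity 1/X would reach 0, that is, X would escape to -∞
in finite time. -/
theorem eventually_gt_of_field_le (h : IsOrbit F k β X W) {M : ℝ} (hM : 0 < M)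
    (hup : ∀ᶠ t in atTop, M ≤ |X t| → F (X t) (W t) ≤ -(X t) ^ 2 / 2) :
    ∀ᶠ t in atTop, -M ≤ X t := by
  rcases eventually_lt_or_gt_of_neg_deriv_on_level (f := X) (f' := fun t => F (X t) (W t))
    (c := -M) (by
      filter_upwards [hup, eventually_gt_atTop 0] with t ht ht0
      refine ⟨h.derivX t ht0, fun e => ?_⟩
      have := ht (by rw [e, abs_neg, abs_of_pos hM])
      rw [e] at this ⊢
      nlinarith) with hl | hg
  · exfalso
    have := tendsto_atTop_of_le_deriv (f := fun t => (X t)⁻¹) (c := 1 / 2)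
      (f' := fun t => - F (X t) (W t) / X t ^ 2) (by norm_num) (by
        filter_upwards [hup, eventually_gt_atTop 0, hl] with t ht ht0 htl
        have hx : X t < 0 := by linarith
        refine ⟨(h.derivX t ht0).inv hx.ne, ?_⟩
        have := ht (by rw [abs_of_neg hx]; linarith)
        rw [le_div_iff₀ (sq_pos_of_neg hx)]
        linarith)
    obtain ⟨t, ht, htl⟩ := ((this.eventually_gt_atTop 0).and hl).exists
    have := inv_pos.1 ht
    linarith
  · exact hg.mono fun t ht => ht.le

theorem eventually_lt_of_field_le (h : IsOrbit F k β X W) {M : ℝ} (hM : 0 < M)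
    (hup : ∀ᶠ t in atTop, M ≤ |X t| → F (X t) (W t) ≤ -(X t) ^ 2 / 2) :
    ∀ᶠ t in atTop, X t ≤ M := by
  rcases eventually_lt_or_gt_of_neg_deriv_on_level (f := X) (f' := fun t => F (X t) (W t))
    (c := M) (by
      filter_upwards [hup, eventually_gt_atTop 0] with t ht ht0
      refine ⟨h.derivX t ht0, fun e => ?_⟩
      have := ht (by rw [e, abs_of_pos hM])
      rw [e] at this ⊢
      nlinarith) with hl | hg
  · exact hl.mono fun t ht => ht.le
  · exfalso
    have := tendsto_atBot_of_deriv_le (f := X) (c := -M ^ 2 / 2)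
      (f' := fun t => F (X t) (W t)) (by nlinarith) (by
        filter_upwards [hup, eventually_gt_atTop 0, hg] with t ht ht0 htl
        refine ⟨h.derivX t ht0, (ht (by rw [abs_of_pos (hM.trans htl)]; exact htl.le)).trans ?_⟩
        nlinarith)
    obtain ⟨t, ht, htl⟩ := ((this.eventually_lt_atBot 0).and hg).exists
    linarith

theorem alternative (h : IsOrbit F k β X W) (hk : 0 < k) (hβ : 0 < β)
    (hF : ∀ x, StrictMono (F x)) (hFc : Continuous (Function.uncurry F)) (h0 : F β w₀ = 0)
    {c w₁ : ℝ} (hc : 0 < c) (hlow : ∀ x ≥ 0, ∀ w ≥ w₁, c * w - x ^ 2 ≤ F x w)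
    (hup : ∀ w₂, ∃ M > 0, ∀ w ≤ w₂, ∀ x, M ≤ |x| → F x w ≤ -x ^ 2 / 2) :
    (0 < w₀ ∧ Tendsto W atTop (𝓝 w₀)) ∨
      ((∀ᶠ t in atTop, X t < β) ∧ Tendsto W atTop (𝓝 0) ∧
        ∃ x ≤ β, Tendsto X atTop (𝓝 x) ∧ F x 0 = 0) := by
  rcases h.trichotomy hk hF h0 with hgt | hlt | heq
  · left
    obtain ⟨T, hT⟩ := eventually_atTop.1 (hgt.and (eventually_gt_atTop 0))
    have hT0 := (hT T le_rfl).2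
    have hmono := h.strictMono_of_gt hk hT0 fun t ht => (hT t ht).1
    rcases tendsto_nhds_or_atTop_of_monotoneOn hmono.monotoneOn with htop | ⟨w, hw, hwle⟩
    · exact absurd htop (h.not_tendsto_atTop hk hβ hc hlow hgt)
    have hw0 : 0 < w := (h.pos T hT0).trans_le (hwle T le_rfl)
    obtain ⟨M, hM, hMF⟩ := hup w
    have hb := h.eventually_lt_of_field_le hM ((eventually_ge_atTop T).mono
      fun t ht => hMF (W t) (hwle t ht) (X t))
    -- Since W is strictly monotone and F is strictly increasing in W, the value F(c, W(t)) changes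
    -- sign at most once.
    obtain ⟨x, hx⟩ := h.exists_tendsto_X (hgt.mono fun t ht => ht.le) hb (fun c => by
      by_cases hex : ∃ t ≥ T, 0 ≤ F c (W t)
      · obtain ⟨a, ha, hFa⟩ := hex
        right
        filter_upwards [eventually_gt_atTop a] with t ht
        exact hFa.trans_lt (hF c (hmono ha (show T ≤ t from ha.trans ht.le) ht))
      · push Not at hex
        exact Or.inl (eventually_atTop.2 ⟨T, hex⟩))
    have e := h.eq_of_limits hk hF hFc h0 hx hw hw0
    rw [← e]
    exact ⟨hw0, hw⟩
  · obtain ⟨T, hT⟩ := eventually_atTop.1 (hlt.and (eventually_gt_atTop 0))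
    have hT0 := (hT T le_rfl).2
    have hanti := h.strictAnti_of_lt hk hT0 fun t ht => (hT t ht).1
    obtain ⟨w, hw, hw0⟩ := tendsto_nhds_of_antitoneOn_of_le hanti.antitoneOn
      fun t ht => (h.pos t (hT t ht).2).le
    obtain ⟨M, hM, hMF⟩ := hup (W T)
    have ha := h.eventually_gt_of_field_le hM ((eventually_ge_atTop T).mono
      fun t ht => hMF (W t) (hanti.antitoneOn Set.self_mem_Ici ht ht) (X t))
    obtain ⟨x, hx⟩ := h.exists_tendsto_X ha (hlt.mono fun t ht => ht.le) (fun c => by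
      by_cases hex : ∃ t ≥ T, F c (W t) ≤ 0
      · obtain ⟨a, ha, hFa⟩ := hex
        left
        filter_upwards [eventually_gt_atTop a] with t ht
        exact (hF c (hanti ha (show T ≤ t from ha.trans ht.le) ht)).trans_le hFa
      · push Not at hex
        exact Or.inr (eventually_atTop.2 ⟨T, hex⟩))
    rcases hw0.eq_or_lt with e | hpos
    · right
      rw [← e] at hw
      exact ⟨hlt, hw, x, le_of_tendsto hx (hlt.mono fun t ht => ht.le), hx,
        h.field_limit_eq_zero hFc hx hw⟩
    · left
      have e := h.eq_of_limits hk hF hFc h0 hx hw hpos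
      rw [← e]
      exact ⟨hpos, hw⟩
  · left
    obtain ⟨t, ht, ht0⟩ := (heq.and (eventually_gt_atTop 0)).exists
    exact ⟨ht ▸ h.pos t ht0, tendsto_const_nhds.congr' (heq.mono fun t ht => ht.symm)⟩

end IsOrbit

/-! ### Precise asymptotics near the equilibria with W = 0. -/

/-- f + Cw decreases and f - Cw increases, which bounds f + Cw from below because w is bounded. -/
theorem exists_tendsto_of_abs_deriv_le {f f' w w' : ℝ → ℝ} {C : ℝ}
    (h : ∀ᶠ t in atTop, HasDerivAt f (f' t) t ∧ HasDerivAt w (w' t) t ∧ |f' t| ≤ -C * w' t)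
    (hw : Tendsto w atTop (𝓝 0)) : ∃ a, Tendsto f atTop (𝓝 a) := by
  obtain ⟨T₀, hT₀⟩ := eventually_atTop.1 (h.and (hw.eventually
    (Metric.ball_mem_nhds 0 one_pos)))
  have hup : AntitoneOn (fun t => f t + C * w t) (Set.Ici T₀) := by
    intro s hs t _ hst
    have := le_of_hasDerivAt_nonneg (f := fun t => -(f t + C * w t)) hst fun r hr =>
      ⟨((hT₀ r (le_trans hs hr.1)).1.1.add ((hT₀ r (le_trans hs hr.1)).1.2.1.const_mul C)).neg, by
        have := (abs_le.1 (hT₀ r (le_trans hs hr.1)).1.2.2).2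
        linarith⟩
    beta_reduce at this ⊢
    linarith
  obtain ⟨a, ha, -⟩ := tendsto_nhds_of_antitoneOn_of_le hup
    (b := f T₀ - C * w T₀ - 2 * |C|) fun t ht => by
      have h1 := le_of_hasDerivAt_nonneg (f := fun t => f t - C * w t) ht fun r hr =>
        ⟨(hT₀ r hr.1).1.1.sub ((hT₀ r hr.1).1.2.1.const_mul C), by
          have := (abs_le.1 (hT₀ r hr.1).1.2.2).1
          linarith⟩
      have h2 : |w t| ≤ 1 := by
        have := (hT₀ t ht).2
        simp only [dist_zero_right, Real.norm_eq_abs] at this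
        exact this.le
      have h3 : |C * w t| ≤ |C| := by
        rw [abs_mul]; exact mul_le_of_le_one_right (abs_nonneg _) h2
      have h4 := (abs_le.1 h3).1
      linarith
  refine ⟨a, ?_⟩
  have := ha.sub (hw.const_mul C)
  simpa using this

theorem tendsto_div_of_deriv_tendsto {f f' : ℝ → ℝ} {d : ℝ}
    (h : ∀ᶠ t in atTop, HasDerivAt f (f' t) t) (hf' : Tendsto f' atTop (𝓝 d)) :
    Tendsto (fun t => f t / t) atTop (𝓝 d) := by
  refine tendsto_order.2 ⟨fun a ha => ?_, fun a ha => ?_⟩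
  · have := tendsto_atTop_of_le_deriv (f := fun t => f t - a * t) (f' := fun t => f' t - a * 1)
      (c := (d - a) / 2) (by linarith) (by
        filter_upwards [h, hf'.eventually_const_lt (show (d + a) / 2 < d by linarith)] with t h1 h2
        exact ⟨h1.sub ((hasDerivAt_id t).const_mul a), by linarith⟩)
    filter_upwards [this.eventually_gt_atTop 0, eventually_gt_atTop 0] with t h1 h2
    rw [lt_div_iff₀ h2]; linarith
  · have := tendsto_atBot_of_deriv_le (f := fun t => f t - a * t) (f' := fun t => f' t - a * 1)
      (c := (d - a) / 2) (by linarith) (by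
        filter_upwards [h, hf'.eventually_lt_const (show d < (d + a) / 2 by linarith)] with t h1 h2
        exact ⟨h1.sub ((hasDerivAt_id t).const_mul a), by linarith⟩)
    filter_upwards [this.eventually_lt_atBot 0, eventually_gt_atTop 0] with t h1 h2
    rw [div_lt_iff₀ h2]; linarith

namespace IsOrbit

variable {F : ℝ → ℝ → ℝ} {k β a b Lam : ℝ} {X W : ℝ → ℝ}

/-- Convergence of `ℓ - a t`, where `ℓ' = X → a < β` at a nondegenerate equilibrium `(a, 0)`. -/
theorem exists_tendsto_primitive (h : IsOrbit F k β X W) (hk : 0 < k) (hLam : 0 < Lam)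
    (hab : a ≠ b) (haβ : a < β) (hX : Tendsto X atTop (𝓝 a)) (hW : Tendsto W atTop (𝓝 0))
    (hFeq : ∀ᶠ t in atTop, F (X t) (W t) = W t / Lam - (X t - a) * (X t - b))
    {l : ℝ → ℝ} (hl : ∀ t > 0, HasDerivAt l (X t) t) :
    ∃ c, Tendsto (fun t => l t - a * t) atTop (𝓝 c) := by
  have hXb : Tendsto (fun t => X t - b) atTop (𝓝 (a - b)) := hX.sub_const b
  have hne : a - b ≠ 0 := sub_ne_zero.2 hab
  set e := |a - b| / 2 with he
  have he0 : 0 < e := half_pos (abs_pos.2 hne)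
  have hbd : ∀ᶠ t in atTop, e ≤ |X t - b| :=
    (hXb.abs.eventually_const_lt (show e < |a - b| by
      have := abs_pos.2 hne; linarith)).mono fun t ht => ht.le
  set d := k * (β - a) / 2 with hd
  have hd0 : 0 < d := half_pos (mul_pos hk (sub_pos.2 haβ))
  -- Adding log|X - b| cancels X - a and leaves the derivative W/(Λ(X - b)). It is integrable
  -- because W ≤ -W'/d eventually.
  obtain ⟨q, hq⟩ := exists_tendsto_of_abs_deriv_le
    (f := fun t => l t - a * t + Real.log (X t - b))
    (f' := fun t => X t - a * 1 + F (X t) (W t) / (X t - b)) (w := W)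
    (w' := fun t => k * (X t - β) * W t) (C := 1 / (Lam * e * d)) (by
      filter_upwards [hbd, hFeq, eventually_gt_atTop 0,
        hX.eventually_lt_const (show a < (a + β) / 2 by linarith)] with t h1 h2 h3 h4
      have hb0 : X t - b ≠ 0 := abs_pos.1 (he0.trans_le h1)
      have hw := h.pos t h3
      refine ⟨((hl t h3).sub ((hasDerivAt_id t).const_mul a)).add
        (((h.derivX t h3).sub_const b).log hb0), h.derivW t h3, ?_⟩
      have e1 : X t - a * 1 + F (X t) (W t) / (X t - b) = W t / Lam / (X t - b) := by
        rw [h2]; field_simp; ring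
      rw [e1, abs_div, abs_of_pos (by positivity)]
      have e2 : W t / Lam / |X t - b| ≤ W t / Lam / e := by gcongr
      have e3 : d ≤ -(k * (X t - β)) := by rw [hd]; nlinarith
      have e4 : W t / Lam / e = 1 / (Lam * e * d) * (d * W t) := by field_simp
      have e5 : 1 / (Lam * e * d) * (d * W t) ≤
          1 / (Lam * e * d) * (-(k * (X t - β)) * W t) := by gcongr
      calc _ ≤ _ := e2
        _ = _ := e4
        _ ≤ _ := e5
        _ = _ := by ring) hW
  refine ⟨q - Real.log (a - b), ?_⟩
  refine (hq.sub (hXb.log hne)).congr fun t => ?_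
  ring

/-- Here X' ≥ s(β - X) = -(s/k)(log W)', so log W + (k/s)X is nondecreasing, which contradicts log W
→ -∞ with X bounded. -/
theorem false_of_tendsto_larger_root (h : IsOrbit F k β X W) (hk : 0 < k) (hLam : 0 < Lam)
    (hb : b < β) (hX : Tendsto X atTop (𝓝 β)) (hW : Tendsto W atTop (𝓝 0))
    (hlt : ∀ᶠ t in atTop, X t < β)
    (hFeq : ∀ᶠ t in atTop, F (X t) (W t) = W t / Lam - (X t - β) * (X t - b)) : False := by
  set s := (β - b) / 2 with hs
  have hs0 : 0 < s := by rw [hs]; linarith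
  obtain ⟨T, hT⟩ := eventually_atTop.1 (hlt.and (hFeq.and ((eventually_gt_atTop 0).and
    (hX.eventually_const_lt (show (β + b) / 2 < β by linarith)))))
  have hmono : ∀ t ≥ T, Real.log (W T) + k / s * X T ≤ Real.log (W t) + k / s * X t := by
    intro t ht
    refine le_of_hasDerivAt_nonneg (f := fun t => Real.log (W t) + k / s * X t)
      (f' := fun r => k * (X r - β) * W r / W r + k / s * F (X r) (W r)) ht fun r hr => ?_
    obtain ⟨h1, h2, h3, h4⟩ := hT r hr.1
    have hw := h.pos r h3
    refine ⟨((h.derivW r h3).log hw.ne').add ((h.derivX r h3).const_mul (k / s)), ?_⟩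
    rw [h2, mul_div_cancel_right₀ _ hw.ne']
    have h5 : s * (β - X r) ≤ W r / Lam - (X r - β) * (X r - b) := by
      have : 0 < W r / Lam := by positivity
      nlinarith
    have h6 : k / s * (s * (β - X r)) ≤ k / s * (W r / Lam - (X r - β) * (X r - b)) := by gcongr
    have h7 : k / s * (s * (β - X r)) = k * (β - X r) := by field_simp
    linarith
  have hlog : Tendsto (fun t => Real.log (W t)) atTop atBot :=
    Real.tendsto_log_nhdsGT_zero.comp (tendsto_nhdsWithin_iff.2
      ⟨hW, (eventually_gt_atTop 0).mono fun t ht => h.pos t ht⟩)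
  have hbot := hlog.atBot_add (hX.const_mul (k / s))
  obtain ⟨t, ht, ht'⟩ := ((hbot.eventually_lt_atBot
    (Real.log (W T) + k / s * X T)).and (eventually_ge_atTop T)).exists
  exact absurd (hmono t ht') (not_le.2 ht)

/-- In the derivative of log W + k log(b - X) the terms k(X - β) cancel. So f = 1/(W(b - X)^k) has a
derivative with a positive limit, f grows linearly, and W decays like 1/t. -/
theorem tendsto_mul_of_smaller_root (h : IsOrbit F k β X W) (hk : 0 < k) (hLam : 0 < Lam)
    (hb : β < b) (hX : Tendsto X atTop (𝓝 β))
    (hFeq : ∀ᶠ t in atTop, F (X t) (W t) = W t / Lam - (X t - β) * (X t - b)) :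
    Tendsto (fun t => t * W t) atTop (𝓝 (Lam * (b - β) / k)) := by
  have hbX : Tendsto (fun t => b - X t) atTop (𝓝 (b - β)) := hX.const_sub b
  have hb0 : 0 < b - β := sub_pos.2 hb
  set f : ℝ → ℝ := fun t => Real.exp (-(Real.log (W t) + k * Real.log (b - X t))) with hf
  set g : ℝ → ℝ := fun t => Real.exp (-(k * Real.log (b - X t))) with hg
  have hgl : Tendsto g atTop (𝓝 (Real.exp (-(k * Real.log (b - β))))) :=
    (Real.continuous_exp.tendsto _).comp ((hbX.log hb0.ne').const_mul k).neg
  set A := Real.exp (-(k * Real.log (b - β))) with hA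
  have hA0 : 0 < A := Real.exp_pos _
  have hfg : ∀ t > 0, f t * W t = g t := fun t ht => by
    simp only [hf, hg, neg_add, Real.exp_add, Real.exp_neg (Real.log _), Real.exp_log (h.pos t ht)]
    have := (h.pos t ht).ne'
    field_simp
  have hder : ∀ᶠ t in atTop, HasDerivAt f (g t * (k / (Lam * (b - X t)))) t := by
    filter_upwards [hFeq, eventually_gt_atTop 0, hbX.eventually_const_lt hb0] with t h1 h2 h3
    have hw := h.pos t h2
    have := ((((h.derivW t h2).log hw.ne').add
      ((((h.derivX t h2).const_sub b).log h3.ne').const_mul k)).neg).exp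
    refine this.congr_deriv ?_
    rw [← hfg t h2, h1]
    simp only [hf, Pi.neg_apply, Pi.add_apply]
    field_simp
    ring
  have hlim := hgl.mul ((tendsto_const_nhds (x := k)).div (hbX.const_mul Lam)
    (mul_pos hLam hb0).ne')
  have hquot := tendsto_div_of_deriv_tendsto hder hlim
  have := hgl.div hquot (by positivity)
  have e : A / (A * (k / (Lam * (b - β)))) = Lam * (b - β) / k := by field_simp
  rw [e] at this
  refine this.congr' ?_
  filter_upwards [eventually_gt_atTop 0] with t ht
  have hft : f t ≠ 0 := (Real.exp_pos _).ne'
  simp only [Pi.div_apply]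
  rw [← hfg t ht]
  field_simp

end IsOrbit

/-! ### The vector field of the radial Pucci equation. -/

/-- The right-hand side of `X' = F(X, W)` satisfied by `X = -r v' / v`, `W = r² v ^ (p - 1)`
along radial solutions; here `m = N - 1`. -/
noncomputable def radialField (m lam Lam μ x w : ℝ) : ℝ :=
  min ((w - μ - m * max (Lam * -x) (lam * -x)) / Lam)
    ((w - μ - m * max (Lam * -x) (lam * -x)) / lam) - x - x ^ 2

section RadialField

variable {m lam Lam μ : ℝ}

theorem radialField_continuous : Continuous (Function.uncurry (radialField m lam Lam μ)) := by
  unfold Function.uncurry radialField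
  fun_prop

theorem radialField_strictMono (hlam : 0 < lam) (hLam : lam ≤ Lam) (x : ℝ) :
    StrictMono (radialField m lam Lam μ x) := by
  intro w w' hw
  have hL : 0 < Lam := hlam.trans_le hLam
  unfold radialField
  have := min_lt_min
    (div_lt_div_of_pos_right (show w - μ - m * max (Lam * -x) (lam * -x) <
      w' - μ - m * max (Lam * -x) (lam * -x) by linarith) hL)
    (div_lt_div_of_pos_right (show w - μ - m * max (Lam * -x) (lam * -x) <
      w' - μ - m * max (Lam * -x) (lam * -x) by linarith) hlam)
  linarith

theorem radialField_eq (hlam : 0 < lam) (hLam : lam ≤ Lam) {x w : ℝ} (hx : 0 ≤ x)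
    (hw : 0 ≤ w - μ + lam * m * x) :
    radialField m lam Lam μ x w = (w - μ + lam * m * x) / Lam - x - x ^ 2 := by
  have hmax : max (Lam * -x) (lam * -x) = lam * -x := max_eq_right (by nlinarith)
  have e : w - μ - m * (lam * -x) = w - μ + lam * m * x := by ring
  rw [radialField, hmax, e, min_eq_left (div_le_div_of_nonneg_left hw hlam hLam)]

theorem radialField_eq_roots (hlam : 0 < lam) (hLam : lam ≤ Lam) {a b : ℝ}
    (hsum : a + b = lam / Lam * m - 1) (hprod : a * b = μ / Lam) {x w : ℝ} (hx : 0 ≤ x)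
    (hw : 0 ≤ w - μ + lam * m * x) :
    radialField m lam Lam μ x w = w / Lam - (x - a) * (x - b) := by
  have hL : 0 < Lam := hlam.trans_le hLam
  rw [radialField_eq hlam hLam hx hw]
  have e1 : (w - μ + lam * m * x) / Lam = w / Lam - μ / Lam + lam / Lam * m * x := by ring
  rw [e1, ← hprod]
  linear_combination x * (-hsum)

/-- On the parabola w = Λ(x - a)(x - b), the bracket deciding the sign of v'' equals Λ(x² + x). For
x ≥ 0 it is nonnegative, so equilibria lie in the regime v' ≤ 0 ≤ v'', where the field is quadratic
in x. -/
theorem roots_identity (hL : 0 < Lam) {a b : ℝ} (hsum : a + b = lam / Lam * m - 1)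
    (hprod : a * b = μ / Lam) (x : ℝ) :
    Lam * (x - a) * (x - b) - μ + lam * m * x = Lam * (x ^ 2 + x) := by
  have h1 : Lam * (a + b) = lam * m - Lam := by rw [hsum]; field_simp
  have h2 : Lam * (a * b) = μ := by rw [hprod]; field_simp
  linear_combination (-x) * h1 + h2

theorem radialField_equilibrium (hlam : 0 < lam) (hLam : lam ≤ Lam) {a b : ℝ}
    (hsum : a + b = lam / Lam * m - 1) (hprod : a * b = μ / Lam) {x : ℝ} (hx : 0 ≤ x) :
    radialField m lam Lam μ x (Lam * (x - a) * (x - b)) = 0 := by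
  have hL : 0 < Lam := hlam.trans_le hLam
  rw [radialField_eq hlam hLam hx, roots_identity hL hsum hprod]
  · field_simp; ring
  · rw [roots_identity hL hsum hprod]; positivity

/-- Outside the quadratic regime the field with w = 0 has no zeros. For x ≥ 0 the minimum is
negative there; for x < 0 a zero would give μ + λ(m - 1)(-x) + λx² ≤ 0. -/
theorem eq_root_of_radialField_zero (hlam : 0 < lam) (hLam : lam ≤ Lam) (hm : 1 ≤ m) (hμ : 0 < μ)
    {a b : ℝ} (hsum : a + b = lam / Lam * m - 1) (hprod : a * b = μ / Lam) {x : ℝ}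
    (h : radialField m lam Lam μ x 0 = 0) : x = a ∨ x = b := by
  have hL : 0 < Lam := hlam.trans_le hLam
  rcases le_or_gt 0 x with hx | hx
  · rcases le_or_gt 0 (0 - μ + lam * m * x) with hw | hw
    · rw [radialField_eq_roots hlam hLam hsum hprod hx hw, zero_div, zero_sub, neg_eq_zero] at h
      rcases mul_eq_zero.1 h with h | h
      · exact Or.inl (sub_eq_zero.1 h)
      · exact Or.inr (sub_eq_zero.1 h)
    · exfalso
      have hmax : max (Lam * -x) (lam * -x) = lam * -x := max_eq_right (by nlinarith)
      rw [radialField, hmax] at h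
      have h1 := min_le_left ((0 - μ - m * (lam * -x)) / Lam) ((0 - μ - m * (lam * -x)) / lam)
      have h2 : (0 - μ - m * (lam * -x)) / Lam < 0 := div_neg_of_neg_of_pos (by linarith) hL
      nlinarith
  · exfalso
    rw [radialField] at h
    have h1 := min_le_right ((0 - μ - m * max (Lam * -x) (lam * -x)) / Lam)
      ((0 - μ - m * max (Lam * -x) (lam * -x)) / lam)
    have h2 : x + x ^ 2 ≤ (0 - μ - m * max (Lam * -x) (lam * -x)) / lam := by linarith
    rw [le_div_iff₀ hlam] at h2
    have h3 : m * (lam * -x) ≤ m * max (Lam * -x) (lam * -x) :=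
      mul_le_mul_of_nonneg_left (le_max_right _ _) (by linarith)
    have h4 : 0 ≤ (m - 1) * (lam * -x) := mul_nonneg (by linarith) (by nlinarith)
    have h5 : 0 ≤ x ^ 2 * lam := by positivity
    nlinarith

/-- Half of w absorbs μ, and the first-order term absorbs -x because λm/Λ ≥ 1. -/
theorem radialField_lower (hlam : 0 < lam) (hLam : lam ≤ Lam) (hm : 1 ≤ lam / Lam * m)
    (hm0 : 0 ≤ m) {x w : ℝ} (hx : 0 ≤ x) (hμ : 0 < μ) (hw : 2 * μ ≤ w) :
    1 / (2 * Lam) * w - x ^ 2 ≤ radialField m lam Lam μ x w := by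
  have hL : 0 < Lam := hlam.trans_le hLam
  have : 0 ≤ lam * m * x := by positivity
  rw [radialField_eq hlam hLam hx (by linarith)]
  have e : (w - μ + lam * m * x) / Lam = 1 / (2 * Lam) * w + (w / 2 - μ) / Lam
    + lam / Lam * m * x := by field_simp; ring
  have h1 : 0 ≤ (w / 2 - μ) / Lam := div_nonneg (by linarith) hL.le
  rw [e]
  nlinarith

theorem radialField_upper (hlam : 0 < lam) (hLam : lam ≤ Lam) (hm0 : 0 ≤ m) (hμ : 0 < μ)
    (w₂ : ℝ) : ∃ M > 0, ∀ w ≤ w₂, ∀ x, M ≤ |x| → radialField m lam Lam μ x w ≤ -x ^ 2 / 2 := by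
  have hL : 0 < Lam := hlam.trans_le hLam
  set A := |w₂| / Lam with hA
  have hA0 : 0 ≤ A := by positivity
  refine ⟨2 * (A + (m + 1)) + 1, by positivity, fun w hw x hx => ?_⟩
  have h1 := min_le_left ((w - μ - m * max (Lam * -x) (lam * -x)) / Lam)
    ((w - μ - m * max (Lam * -x) (lam * -x)) / lam)
  have h2 : (w - μ - m * max (Lam * -x) (lam * -x)) / Lam ≤ A + m * |x| := by
    have h3 : m * (lam * -x) ≤ m * max (Lam * -x) (lam * -x) :=
      mul_le_mul_of_nonneg_left (le_max_right _ _) hm0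
    have h4 : lam * x ≤ Lam * |x| :=
      (mul_le_mul_of_nonneg_left (le_abs_self x) hlam.le).trans
        (mul_le_mul_of_nonneg_right hLam (abs_nonneg x))
    have h5 : m * (lam * x) ≤ m * (Lam * |x|) := mul_le_mul_of_nonneg_left h4 hm0
    have h6 : (A + m * |x|) * Lam = |w₂| + m * (Lam * |x|) := by rw [hA]; field_simp
    rw [div_le_iff₀ hL, h6]
    have := le_abs_self w₂
    nlinarith
  have h3 : -x ≤ |x| := neg_le_abs x
  have h4 : x ^ 2 = |x| ^ 2 := (sq_abs x).symm
  have h5 : radialField m lam Lam μ x w ≤ A + m * |x| + |x| - |x| ^ 2 := by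
    rw [radialField]; linarith
  refine h5.trans ?_
  rw [h4]
  have hx1 : 1 ≤ |x| := by linarith
  nlinarith [mul_nonneg hA0 (sub_nonneg.2 hx1), mul_nonneg (abs_nonneg x) (sub_nonneg.2 hx)]

end RadialField

/-! ### Hessian and Pucci operator of a radial function. -/

section Radial

variable {E : Type*} [NormedAddCommGroup E] [InnerProductSpace ℝ E]

theorem hasFDerivAt_norm_of_ne_zero {x : E} (hx : x ≠ 0) :
    HasFDerivAt (fun y : E => ‖y‖) (‖x‖⁻¹ • innerSL ℝ x) x := by
  have h := ((hasFDerivAt_id x).norm_sq).sqrt (by simpa using hx)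
  simp only [id, Real.sqrt_sq (norm_nonneg _)] at h
  refine h.congr_fderiv ?_
  ext y
  simp only [smul_apply, ContinuousLinearMap.comp_apply,
    ContinuousLinearMap.id_apply, smul_eq_mul, nsmul_eq_mul]
  have := norm_ne_zero_iff.2 hx
  field_simp
  simp

theorem hasFDerivAt_of_radial {u : E → ℝ} {v : ℝ → ℝ} {d : ℝ} {x : E} (hx : x ≠ 0)
    (hu : u =ᶠ[𝓝 x] fun y => v ‖y‖) (hv : HasDerivAt v d ‖x‖) :
    HasFDerivAt u ((d / ‖x‖) • innerSL ℝ x) x := by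
  refine ((hv.comp_hasFDerivAt x (hasFDerivAt_norm_of_ne_zero hx)).congr_of_eventuallyEq
    hu).congr_fderiv ?_
  rw [smul_smul, div_eq_mul_inv]

theorem fderiv_fderiv_of_radial {u : E → ℝ} {v v' : ℝ → ℝ} {d : ℝ} {x : E} (hx : x ≠ 0)
    (hu : ∀ᶠ y in 𝓝 x, u y = v ‖y‖) (hv : ∀ᶠ r in 𝓝 ‖x‖, HasDerivAt v (v' r) r)
    (hv' : HasDerivAt v' d ‖x‖) (a b : E) :
    fderiv ℝ (fderiv ℝ u) x a b = v' ‖x‖ / ‖x‖ * inner ℝ a b +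
      (d * ‖x‖ - v' ‖x‖) / ‖x‖ ^ 3 * inner ℝ x a * inner ℝ x b := by
  have hx0 := norm_ne_zero_iff.2 hx
  have heq : fderiv ℝ u =ᶠ[𝓝 x] fun y => (v' ‖y‖ / ‖y‖) • innerSL ℝ y := by
    filter_upwards [hu.eventually_nhds, continuous_norm.continuousAt.eventually hv,
      isOpen_ne.mem_nhds hx] with y h1 h2 h3
    exact (hasFDerivAt_of_radial h3 h1 h2).fderiv
  have hk : HasDerivAt (fun r => v' r / r) ((d * ‖x‖ - v' ‖x‖ * 1) / ‖x‖ ^ 2) ‖x‖ :=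
    hv'.div (hasDerivAt_id _) hx0
  have h := (hk.comp_hasFDerivAt x (hasFDerivAt_norm_of_ne_zero hx)).fun_smul
    ((innerSL ℝ).hasFDerivAt (x := x))
  rw [heq.fderiv_eq, HasFDerivAt.fderiv (f := fun y => (v' ‖y‖ / ‖y‖) • innerSL ℝ y) h]
  simp
  field_simp
  rfl

end Radial

theorem sum_filter_pos_neg_eq_max {lam Lam : ℝ} (hLam : lam ≤ Lam) (s : Multiset ℝ) :
    Lam * (s.filter (fun m => 0 < m)).sum + lam * (s.filter (fun m => m < 0)).sum =
      (s.map fun m => max (Lam * m) (lam * m)).sum := by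
  induction s using Multiset.induction_on with
  | empty => simp
  | cons a s ih =>
    rw [Multiset.map_cons, Multiset.sum_cons, ← ih]
    rcases lt_trichotomy a 0 with h | h | h
    · rw [Multiset.filter_cons_of_neg (p := fun m => 0 < m) s h.not_gt,
        Multiset.filter_cons_of_pos (p := fun m => m < 0) s h, Multiset.sum_cons, max_eq_right (by nlinarith)]
      ring
    · subst h; simp
    · rw [Multiset.filter_cons_of_neg (p := fun m => m < 0) s h.not_gt,
        Multiset.filter_cons_of_pos (p := fun m => 0 < m) s h, Multiset.sum_cons, max_eq_left (by nlinarith)]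
      ring

theorem pucciSup_diagonal {N : ℕ} {lam Lam : ℝ} (hLam : lam ≤ Lam) (d : Fin N → ℝ) :
    pucciSup lam Lam (Matrix.diagonal d) = ∑ i, max (Lam * d i) (lam * d i) := by
  have hroots : (Matrix.diagonal d).charpoly.roots = Finset.univ.val.map d := by
    rw [Matrix.charpoly_diagonal]
    have := Polynomial.roots_multiset_prod_X_sub_C (Finset.univ.val.map d)
    rwa [Multiset.map_map] at this
  rw [pucciSup, sum_filter_pos_neg_eq_max hLam, hroots, Multiset.map_map]
  rfl

theorem hessianMatrix_of_radial {N : ℕ} (i₀ : Fin N) {u : EuclideanSpace ℝ (Fin N) → ℝ}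
    {v v' : ℝ → ℝ} {d r : ℝ} (hr : 0 < r)
    (hu : ∀ᶠ y in 𝓝 (EuclideanSpace.single i₀ r), u y = v ‖y‖)
    (hv : ∀ᶠ s in 𝓝 r, HasDerivAt v (v' s) s) (hv' : HasDerivAt v' d r) :
    hessianMatrix u (EuclideanSpace.single i₀ r) =
      Matrix.diagonal fun i => if i = i₀ then d else v' r / r := by
  have hn : ‖(EuclideanSpace.single i₀ r : EuclideanSpace ℝ (Fin N))‖ = r := by
    simp [abs_of_pos hr]
  have hx : (EuclideanSpace.single i₀ r : EuclideanSpace ℝ (Fin N)) ≠ 0 := by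
    rw [← norm_ne_zero_iff, hn]; exact hr.ne'
  ext i j
  rw [hessianMatrix, Matrix.of_apply, fderiv_fderiv_of_radial hx hu (by rwa [hn]) (by rwa [hn]), hn]
  simp only [EuclideanSpace.inner_single_left, PiLp.single_apply, Matrix.diagonal_apply]
  by_cases hij : i = j
  · subst hij
    by_cases hi : i = i₀
    · simp [hi]; field_simp; ring
    · simp [hi, Ne.symm hi]
  · by_cases hi : i = i₀
    · subst hi; simp [hij]
    · simp [Ne.symm hi, hij]

theorem pucciSup_hessianMatrix_of_radial {N : ℕ} {lam Lam : ℝ} (hLam : lam ≤ Lam) (i₀ : Fin N)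
    {u : EuclideanSpace ℝ (Fin N) → ℝ} {v v' : ℝ → ℝ} {d r : ℝ} (hr : 0 < r)
    (hu : ∀ᶠ y in 𝓝 (EuclideanSpace.single i₀ r), u y = v ‖y‖)
    (hv : ∀ᶠ s in 𝓝 r, HasDerivAt v (v' s) s) (hv' : HasDerivAt v' d r) :
    pucciSup lam Lam (hessianMatrix u (EuclideanSpace.single i₀ r)) =
      max (Lam * d) (lam * d) +
        ((N : ℝ) - 1) * max (Lam * (v' r / r)) (lam * (v' r / r)) := by
  rw [hessianMatrix_of_radial i₀ hr hu hv hv', pucciSup_diagonal hLam,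
    ← Finset.add_sum_erase _ _ (Finset.mem_univ i₀)]
  congr 1
  · simp
  · rw [Finset.sum_congr rfl (g := fun _ => max (Lam * (v' r / r)) (lam * (v' r / r)))
      fun i hi => by simp [Finset.ne_of_mem_erase hi]]
    simp [Finset.card_erase_of_mem, Nat.cast_pred (Fin.pos i₀)]

/-! ### From the equation to the planar system. -/

/-- Multiplying the equation by r²/v makes it scale invariant. The minimum in `radialField` inverts
y ↦ max(Λy, λy) and so solves for the second derivative. -/
theorem radialField_eq_of_equation {m lam Lam μ p r v d₁ d₂ : ℝ} (hlam : 0 < lam)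
    (hLam : lam ≤ Lam) (hr : 0 < r) (hv : 0 < v)
    (h : max (Lam * d₂) (lam * d₂) + m * max (Lam * (d₁ / r)) (lam * (d₁ / r)) + μ * (v / r ^ 2) =
      v ^ p) :
    radialField m lam Lam μ (-(r * d₁) / v) (r ^ 2 * v ^ (p - 1)) =
      r ^ 2 * d₂ / v + r * d₁ / v - (r * d₁ / v) ^ 2 := by
  have hL : 0 < Lam := hlam.trans_le hLam
  have hc : 0 ≤ r ^ 2 / v := by positivity
  have hx : - (-(r * d₁) / v) = d₁ / r * (r ^ 2 / v) := by field_simp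
  have hy : r ^ 2 * d₂ / v = d₂ * (r ^ 2 / v) := by field_simp
  have h1 : max (Lam * -(-(r * d₁) / v)) (lam * -(-(r * d₁) / v)) =
      max (Lam * (d₁ / r)) (lam * (d₁ / r)) * (r ^ 2 / v) := by
    rw [hx, ← mul_assoc, ← mul_assoc, max_mul_of_nonneg _ _ hc]
  have h2 : r ^ 2 * v ^ (p - 1) = v ^ p * (r ^ 2 / v) := by
    rw [Real.rpow_sub_one hv.ne']; field_simp
  have h3 : r ^ 2 * v ^ (p - 1) - μ - m * max (Lam * -(-(r * d₁) / v)) (lam * -(-(r * d₁) / v)) =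
      max (Lam * (r ^ 2 * d₂ / v)) (lam * (r ^ 2 * d₂ / v)) := by
    rw [h1, h2, hy, ← mul_assoc Lam d₂, ← mul_assoc lam d₂, ← mul_assoc m,
      ← max_mul_of_nonneg _ _ hc, ← h]
    field_simp
    ring
  have h4 : ∀ y : ℝ, min (max (Lam * y) (lam * y) / Lam) (max (Lam * y) (lam * y) / lam) = y := by
    intro y
    rcases le_total 0 y with h0 | h0
    · rw [max_eq_left (by nlinarith), mul_div_cancel_left₀ _ hL.ne', min_eq_left]
      rw [le_div_iff₀ hlam]; nlinarith
    · rw [max_eq_right (by nlinarith), mul_div_cancel_left₀ _ hlam.ne', min_eq_right]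
      rw [le_div_iff₀ hL]; nlinarith
  rw [radialField, h3, h4]
  ring

theorem single_mem_puncturedBall {N : ℕ} (i₀ : Fin N) {r : ℝ} (hr : r ∈ Set.Ioo (0 : ℝ) 1) :
    EuclideanSpace.single i₀ r ∈ puncturedBall N := by
  refine ⟨?_, ?_⟩
  · simpa [abs_of_pos hr.1] using hr.2
  · simpa using hr.1.ne'

theorem isOpen_puncturedBall (N : ℕ) : IsOpen (puncturedBall N) :=
  Metric.isOpen_ball.sdiff isClosed_singleton

theorem norm_mem_Ioo {N : ℕ} {x : EuclideanSpace ℝ (Fin N)} (hx : x ∈ puncturedBall N) :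
    ‖x‖ ∈ Set.Ioo (0 : ℝ) 1 :=
  ⟨norm_pos_iff.2 hx.2, by simpa using hx.1⟩

/-- In logarithmic variables a positive radial solution gives an orbit of the planar system. -/
theorem IsPosRadialSolution.exists_orbit {N : ℕ} {lam Lam μ p : ℝ} (hN : 0 < N) (hlam : 0 < lam)
    (hLam : lam ≤ Lam) (hp : 1 < p) {u : EuclideanSpace ℝ (Fin N) → ℝ}
    (hu : IsPosRadialSolution lam Lam μ p u) :
    ∃ l X W : ℝ → ℝ, IsOrbit (radialField ((N : ℝ) - 1) lam Lam μ) (p - 1) (2 / (p - 1)) X W ∧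
      (∀ t > 0, HasDerivAt l (X t) t) ∧ (∀ t, W t = Real.exp ((p - 1) * l t - 2 * t)) ∧
      ∀ x ∈ puncturedBall N, u x = Real.exp (l (-Real.log ‖x‖)) := by
  set i₀ : Fin N := ⟨0, hN⟩
  set v : ℝ → ℝ := fun r => u (EuclideanSpace.single i₀ r) with hvdef
  have huv : ∀ x ∈ puncturedBall N, u x = v ‖x‖ := fun x hx =>
    hu.radial x hx _ (single_mem_puncturedBall i₀ (norm_mem_Ioo hx)) (by simp)
  have hvpos : ∀ r ∈ Set.Ioo (0 : ℝ) 1, 0 < v r := fun r hr =>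
    hu.pos _ (single_mem_puncturedBall i₀ hr)
  have hsmooth : ContDiff ℝ 2 fun r : ℝ => (EuclideanSpace.single i₀ r : EuclideanSpace ℝ (Fin N)) := by
    have : (fun r : ℝ => (EuclideanSpace.single i₀ r : EuclideanSpace ℝ (Fin N))) =
        fun r => r • EuclideanSpace.single i₀ (1 : ℝ) := by
      funext r; ext j; simp
    rw [this]
    fun_prop
  have hv2 : ContDiffOn ℝ 2 v (Set.Ioo 0 1) :=
    hu.contDiffOn.comp hsmooth.contDiffOn fun r hr => single_mem_puncturedBall i₀ hr
  have hv1 : ContDiffOn ℝ 1 (deriv v) (Set.Ioo 0 1) :=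
    hv2.deriv_of_isOpen isOpen_Ioo (by norm_num)
  have hd1 : ∀ r ∈ Set.Ioo (0 : ℝ) 1, HasDerivAt v (deriv v r) r := fun r hr =>
    ((hv2.differentiableOn (by norm_num)).differentiableAt (isOpen_Ioo.mem_nhds hr)).hasDerivAt
  have hd2 : ∀ r ∈ Set.Ioo (0 : ℝ) 1, HasDerivAt (deriv v) (deriv (deriv v) r) r := fun r hr =>
    ((hv1.differentiableOn (by norm_num)).differentiableAt (isOpen_Ioo.mem_nhds hr)).hasDerivAt
  have hode : ∀ r ∈ Set.Ioo (0 : ℝ) 1,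
      max (Lam * deriv (deriv v) r) (lam * deriv (deriv v) r) +
        ((N : ℝ) - 1) * max (Lam * (deriv v r / r)) (lam * (deriv v r / r)) + μ * (v r / r ^ 2) =
      v r ^ p := by
    intro r hr
    have hmem := single_mem_puncturedBall i₀ hr
    have h1 := hu.equation _ hmem
    rw [pucciSup_hessianMatrix_of_radial hLam i₀ hr.1 (v := v) (v' := deriv v)
      (d := deriv (deriv v) r)
      (((isOpen_puncturedBall N).eventually_mem hmem).mono huv)
      ((isOpen_Ioo.eventually_mem hr).mono hd1) (hd2 r hr)] at h1
    simpa [abs_of_pos hr.1] using h1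
  have hexp : ∀ t > 0, Real.exp (-t) ∈ Set.Ioo (0 : ℝ) 1 := fun t ht =>
    ⟨Real.exp_pos _, by simpa using ht⟩
  have hder : ∀ t : ℝ, HasDerivAt (fun t => Real.exp (-t)) (-Real.exp (-t)) t := fun t => by
    simpa using (hasDerivAt_id t).neg.exp
  set l : ℝ → ℝ := fun t => Real.log (v (Real.exp (-t))) with hl
  set X : ℝ → ℝ := fun t =>
    -(Real.exp (-t) * deriv v (Real.exp (-t))) / v (Real.exp (-t)) with hX
  have hlder : ∀ t > 0, HasDerivAt l (X t) t := fun t ht => by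
    have := (HasDerivAt.comp (h₂ := v) t (hd1 _ (hexp t ht)) (hder t)).log (hvpos _ (hexp t ht)).ne'
    refine this.congr_deriv ?_
    simp only [hX, Function.comp]
    ring
  have hW : ∀ t > 0, Real.exp ((p - 1) * l t - 2 * t) =
      Real.exp (-t) ^ 2 * v (Real.exp (-t)) ^ (p - 1) := fun t ht => by
    rw [Real.rpow_def_of_pos (hvpos _ (hexp t ht)), ← Real.exp_nat_mul, ← Real.exp_add]
    congr 1
    simp only [hl]
    push_cast
    ring
  refine ⟨l, X, fun t => Real.exp ((p - 1) * l t - 2 * t), ⟨fun t _ => Real.exp_pos _,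
    fun t ht => ?_, fun t ht => ?_⟩, hlder, fun _ => rfl, fun x hx => ?_⟩
  · have hr := hexp t ht
    have hv0 := hvpos _ hr
    have h1 : HasDerivAt X _ t := (((hder t).mul (HasDerivAt.comp (h₂ := deriv v) t (hd2 _ hr) (hder t))).neg).div
      (HasDerivAt.comp (h₂ := v) t (hd1 _ hr) (hder t)) hv0.ne'
    refine h1.congr_deriv ?_
    simp only [hW t ht, hX]
    rw [radialField_eq_of_equation hlam hLam hr.1 hv0 (hode _ hr)]
    simp only [Function.comp, Pi.neg_apply, Pi.mul_apply]
    field_simp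
    ring
  · have h1 := (((hlder t ht).const_mul (p - 1)).sub ((hasDerivAt_id t).const_mul 2)).exp
    refine h1.congr_deriv ?_
    have : p - 1 ≠ 0 := by linarith
    simp only [id, Pi.sub_apply]
    field_simp
  · have hn := norm_mem_Ioo hx
    rw [huv x hx]
    simp only [hl, neg_neg, Real.exp_log hn.1, Real.exp_log (hvpos _ hn)]

/-! ### Return to the variable x and the four ranges of p. -/

theorem tendsto_of_eq_comp_neg_log {N : ℕ} {f : EuclideanSpace ℝ (Fin N) → ℝ} {g : ℝ → ℝ} {c : ℝ}
    (hfg : ∀ x ∈ puncturedBall N, f x = g (-Real.log ‖x‖)) (hg : Tendsto g atTop (𝓝 c)) :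
    Tendsto f (𝓝[≠] 0) (𝓝 c) := by
  have h1 : Tendsto (fun x : EuclideanSpace ℝ (Fin N) => -Real.log ‖x‖) (𝓝[≠] 0) atTop :=
    tendsto_neg_atBot_atTop.comp (Real.tendsto_log_nhdsGT_zero.comp (tendsto_norm_nhdsNE_zero))
  refine (hg.comp h1).congr' ?_
  filter_upwards [self_mem_nhdsWithin, nhdsWithin_le_nhds (Metric.ball_mem_nhds 0 one_pos)]
    with x h0 hx
  exact (hfg x ⟨hx, h0⟩).symm

theorem norm_rpow_mul_exp {N : ℕ} {x : EuclideanSpace ℝ (Fin N)} (hx : x ∈ puncturedBall N)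
    (γ y : ℝ) : ‖x‖ ^ γ * Real.exp y = Real.exp (y - γ * -Real.log ‖x‖) := by
  rw [Real.rpow_def_of_pos (norm_mem_Ioo hx).1, ← Real.exp_add]
  congr 1
  ring

theorem behavesLikePower_of_tendsto {N : ℕ} {u : EuclideanSpace ℝ (Fin N) → ℝ} {l : ℝ → ℝ}
    {γ c : ℝ} (hu : ∀ x ∈ puncturedBall N, u x = Real.exp (l (-Real.log ‖x‖)))
    (h : Tendsto (fun t => l t - γ * t) atTop (𝓝 c)) : BehavesLikePower u γ (Real.exp c) :=
  tendsto_of_eq_comp_neg_log (fun x hx => by rw [hu x hx, norm_rpow_mul_exp hx, Function.comp])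
    ((Real.continuous_exp.tendsto c).comp h)

theorem theorem1p2 (N : ℕ) (lam Lam μ p : ℝ)
    (hlam : 0 < lam) (hLam : lam ≤ Lam)
    (hdim : 2 < dimPlus N lam Lam)
    (hμ : 0 < μ) (hμ' : μ < lamBar N lam Lam) (hp : 1 < p)
    (u : EuclideanSpace ℝ (Fin N) → ℝ)
    (hu : IsPosRadialSolution lam Lam μ p u) :
    (p < pStar N lam Lam μ →
      BehavesLikePower u (2 / (p - 1)) (constK N lam Lam μ p) ∨
      (∃ c₁ : ℝ, 0 < c₁ ∧ BehavesLikePower u (tauPlus N lam Lam μ) c₁) ∨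
      (∃ c₂ : ℝ, 0 < c₂ ∧ BehavesLikePower u (tauMinus N lam Lam μ) c₂)) ∧
    (pStar N lam Lam μ ≤ p → p < pStarStar N lam Lam μ →
      ∃ c : ℝ, 0 < c ∧ BehavesLikePower u (tauMinus N lam Lam μ) c) ∧
    (p = pStarStar N lam Lam μ →
      Tendsto (fun x => ‖x‖ ^ tauMinus N lam Lam μ *
          (-Real.log ‖x‖) ^ (tauMinus N lam Lam μ / 2) * u x)
        (𝓝[≠] 0) (𝓝 (constKBar N lam Lam μ))) ∧
    (pStarStar N lam Lam μ < p →
      BehavesLikePower u (2 / (p - 1)) (constK N lam Lam μ p)) := by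
  have hL : 0 < Lam := hlam.trans_le hLam
  have hratio : lam / Lam ≤ 1 := (div_le_one hL).2 hLam
  have hratio0 : 0 < lam / Lam := div_pos hlam hL
  have hm1 : 1 < lam / Lam * ((N : ℝ) - 1) := by unfold dimPlus at hdim; linarith
  have hm0 : 0 < (N : ℝ) - 1 := by
    by_contra hc
    have := mul_nonpos_of_nonneg_of_nonpos hratio0.le (not_lt.1 hc)
    linarith
  have hm : 1 ≤ (N : ℝ) - 1 := by nlinarith
  have hN : 0 < N := by
    have : (0 : ℝ) < N := by linarith
    exact_mod_cast this
  set τ := tauMid N lam Lam with hτ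
  set s := √(τ ^ 2 - μ / Lam) with hs
  set a := tauPlus N lam Lam μ with ha
  set b := tauMinus N lam Lam μ with hb
  have ha' : a = τ + s := rfl
  have hb' : b = τ - s := rfl
  have hτ0 : 0 < τ := by rw [hτ, tauMid]; linarith
  have hμL : μ / Lam < τ ^ 2 := by rw [div_lt_iff₀ hL]; unfold lamBar at hμ'; linarith
  have hs0 : 0 < s := Real.sqrt_pos.2 (by linarith)
  have hs2 : s ^ 2 = τ ^ 2 - μ / Lam := Real.sq_sqrt (by linarith)
  have hprod : a * b = μ / Lam := by rw [ha', hb']; linear_combination -hs2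
  have hsum : a + b = lam / Lam * ((N : ℝ) - 1) - 1 := by
    rw [ha', hb', hτ, tauMid, dimPlus]; ring
  have ha0 : 0 < a := by rw [ha']; linarith
  have hb0 : 0 < b := by
    have : 0 < a * b := by rw [hprod]; positivity
    exact (pos_iff_pos_of_mul_pos this).1 ha0
  have hba : b < a := by linarith
  have hk : 0 < p - 1 := by linarith
  obtain ⟨l, X, W, horb, hl, hWl, hul⟩ := hu.exists_orbit hN hlam hLam hp
  set β := 2 / (p - 1) with hβ
  have hβ0 : 0 < β := by positivity
  have hkβ : (p - 1) * β = 2 := by rw [hβ]; field_simp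
  have hrel : ∀ c > 0, (p < 1 + 2 / c ↔ c < β) := fun c hc => by
    rw [hβ, lt_div_iff₀ hk, ← sub_lt_iff_lt_add', lt_div_iff₀ hc, mul_comm]
  have hrel' : ∀ c > 0, (1 + 2 / c < p ↔ β < c) := fun c hc => by
    rw [hβ, div_lt_iff₀ hk, ← lt_sub_iff_add_lt', div_lt_iff₀ hc, mul_comm]
  have heq0 := radialField_equilibrium hlam hLam hsum hprod hβ0.le
  -- This rests on r^β u = W^(1/(p-1)).
  have hK : Tendsto W atTop (𝓝 (Lam * (β - a) * (β - b))) → 0 < Lam * (β - a) * (β - b) →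
      BehavesLikePower u β (constK N lam Lam μ p) := by
    intro hW hpos
    refine tendsto_of_eq_comp_neg_log (g := fun t => W t ^ (1 / (p - 1))) (fun x hx => ?_)
      (hW.rpow_const (Or.inl hpos.ne'))
    rw [hul x hx, norm_rpow_mul_exp hx, hWl, ← Real.exp_mul]
    congr 1
    rw [hβ]; field_simp
  have hfield : ∀ y > 0, (y = a ∨ y = b) → Tendsto X atTop (𝓝 y) → Tendsto W atTop (𝓝 0) →
      ∀ᶠ t in atTop, radialField ((N : ℝ) - 1) lam Lam μ (X t) (W t) =
        W t / Lam - (X t - a) * (X t - b) := by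
    intro y hy hyab hX hW
    have h1 : Tendsto (fun t => W t - μ + lam * ((N : ℝ) - 1) * X t) atTop
        (𝓝 (0 - μ + lam * ((N : ℝ) - 1) * y)) := (hW.sub_const μ).add (hX.const_mul _)
    have h2 : 0 < 0 - μ + lam * ((N : ℝ) - 1) * y := by
      have e := roots_identity hL hsum hprod y
      have e2 : Lam * (y - a) * (y - b) = 0 := by rcases hyab with h | h <;> rw [h] <;> ring
      rw [e2] at e
      rw [e]; positivity
    filter_upwards [hX.eventually_const_lt hy, h1.eventually_const_lt h2] with t h3 h4
    exact radialField_eq_roots hlam hLam hsum hprod h3.le h4.le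
  have hpow : ∀ y y', (y = a ∧ y' = b ∨ y = b ∧ y' = a) → y < β → Tendsto X atTop (𝓝 y) →
      Tendsto W atTop (𝓝 0) → ∃ c : ℝ, 0 < c ∧ BehavesLikePower u y c := by
    intro y y' hyy hyβ hX hW
    have hy0 : 0 < y := by rcases hyy with ⟨h, -⟩ | ⟨h, -⟩ <;> rw [h] <;> assumption
    have hne : y ≠ y' := by
      rcases hyy with ⟨h, h'⟩ | ⟨h, h'⟩ <;> rw [h, h']
      exacts [hba.ne', hba.ne]
    obtain ⟨c, hc⟩ := horb.exists_tendsto_primitive hk hL hne hyβ hX hW (by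
      filter_upwards [hfield y hy0 (hyy.imp And.left And.left) hX hW] with t ht
      rw [ht]
      rcases hyy with ⟨h, h'⟩ | ⟨h, h'⟩ <;> rw [h, h']
      ring) hl
    exact ⟨_, Real.exp_pos c, behavesLikePower_of_tendsto hul hc⟩
  have halt := horb.alternative hk hβ0 (radialField_strictMono hlam hLam) radialField_continuous
    heq0 (c := 1 / (2 * Lam)) (w₁ := 2 * μ) (by positivity)
    (fun x hx w hw => radialField_lower hlam hLam hm1.le hm0.le hx hμ hw)
    (radialField_upper hlam hLam hm0.le hμ)
  have hroot : ∀ x, radialField ((N : ℝ) - 1) lam Lam μ x 0 = 0 → x = a ∨ x = b := fun x =>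
    eq_root_of_radialField_zero hlam hLam hm hμ hsum hprod
  refine ⟨fun h => ?_, fun h h' => ?_, fun h => ?_, fun h => ?_⟩
  · have haβ : a < β := (hrel a ha0).1 h
    rcases halt with ⟨h1, h2⟩ | ⟨-, h2, x, -, h4, h5⟩
    · exact Or.inl (hK h2 h1)
    · rcases hroot x h5 with rfl | rfl
      · exact Or.inr (Or.inl (hpow _ _ (Or.inl ⟨rfl, rfl⟩) haβ h4 h2))
      · exact Or.inr (Or.inr (hpow _ _ (Or.inr ⟨rfl, rfl⟩) (hba.trans haβ) h4 h2))
  · have hβa : β ≤ a := not_lt.1 fun hc => absurd ((hrel a ha0).2 hc) (not_lt.2 h)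
    have hbβ : b < β := (hrel b hb0).1 h'
    -- For b < β ≤ a the value w₀ is not positive, so W → 0. The limit a of X could occur only for β
    -- = a, that is p = p*, and the resonance argument excludes it.
    rcases halt with ⟨h1, -⟩ | ⟨h1, h2, x, h3, h4, h5⟩
    · exfalso
      have : Lam * (β - a) * (β - b) ≤ 0 :=
        mul_nonpos_of_nonpos_of_nonneg (mul_nonpos_of_nonneg_of_nonpos hL.le (by linarith))
          (by linarith)
      linarith
    · rcases hroot x h5 with rfl | rfl
      · exfalso
        have e : a = β := le_antisymm h3 hβa
        have hf := hfield _ ha0 (Or.inl rfl) h4 h2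
        rw [e] at h4 hf
        exact horb.false_of_tendsto_larger_root hk hL hbβ h4 h2 h1 hf
      · exact hpow _ _ (Or.inr ⟨rfl, rfl⟩) hbβ h4 h2
  · have hbβ : b = β := by
      refine le_antisymm (not_lt.1 fun hc => ?_) (not_lt.1 fun hc => ?_)
      · exact absurd ((hrel' b hb0).2 hc) (by rw [h]; exact lt_irrefl _)
      · exact absurd ((hrel b hb0).2 hc) (by rw [h]; exact lt_irrefl _)
    rcases halt with ⟨h1, -⟩ | ⟨h1, h2, x, h3, h4, h5⟩
    · rw [hbβ, sub_self, mul_zero] at h1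
      exact absurd h1 (lt_irrefl _)
    · have hxb : x = b := by
        rcases hroot x h5 with h6 | h6
        · linarith
        · exact h6
      rw [hxb] at h4
      have hf := hfield _ hb0 (Or.inr rfl) h4 h2
      rw [hbβ] at h4
      have hlim := horb.tendsto_mul_of_smaller_root hk hL (b := a) (by linarith) h4 (by
        filter_upwards [hf] with t ht
        rw [ht, hbβ]; ring)
      have hval : Lam * (a - β) / (p - 1) = Lam * b * (τ - b) := by
        rw [div_eq_iff hk.ne', ← hbβ]
        rw [← hbβ] at hkβ
        have e : a - b = 2 * (τ - b) := by rw [ha', hb']; ring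
        rw [e]
        linear_combination (-(Lam * (τ - b))) * hkβ
      rw [hval] at hlim
      -- Since p - 1 = 2/b, the rescaled solution is exactly (tW)^(b/2).
      refine tendsto_of_eq_comp_neg_log (g := fun t => (max t 0 * W t) ^ (b / 2)) (fun x hx => ?_) ?_
      · have hn := norm_mem_Ioo hx
        have hlog : 0 ≤ -Real.log ‖x‖ := by
          have := Real.log_neg hn.1 hn.2; linarith
        rw [max_eq_left hlog, mul_right_comm, hul x hx, norm_rpow_mul_exp hx, hWl,
          Real.mul_rpow hlog (Real.exp_pos _).le, ← Real.exp_mul, mul_comm]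
        congr 2
        rw [← hbβ] at hkβ
        linear_combination (-(l (-Real.log ‖x‖)) / 2) * hkβ
      · have hb2 : 0 ≤ b / 2 := by linarith
        refine Tendsto.rpow_const (p := b / 2) ?_ (Or.inr hb2)
        refine hlim.congr' ?_
        filter_upwards [eventually_ge_atTop 0] with t ht
        rw [max_eq_left ht]
  · have hβb : β < b := (hrel' b hb0).1 h
    -- Both roots exceed β, so X has no admissible limit with W → 0.
    rcases halt with ⟨h1, h2⟩ | ⟨-, -, x, h3, -, h5⟩
    · exact hK h2 h1
    · rcases hroot x h5 with h6 | h6 <;> linarith
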